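/- Consider $M$ clients and $N\ge M$ data points in total. Client $i$ holds $n_i\ge 1$ samples $(x_{ij},y_{ij})$, $\sum_{i=1}^M n_i=N$, with $$y_{ij}=x_{ij}^\top B\alpha_i+\xi_{ij},\qquad x_{ij}\sim N(0,I_d),\quad \xi_{ij}\sim N(0,1),$$ all $x_{ij}$ and $\xi_{ij}$ being independent, where $B\in\mathcal O^{d\times k}$ (the real $d\times k$ matrices with $B^\top B=I_k$) and $\alpha_i\in\mathbb R^k$. For $B,\widehat B\in\mathcal O^{d\times k}$ let $\|\sin\Theta(\widehat B,B)\|=\|\widehat B\widehat B^\top-BB^\top\|$ (spectral norm). For $\lambda_1\ge\lambda_k>0$ and constants $K,\ell,U>0$ let $$\Psi_{\lambda_1,\lambda_k}=\Big\{(\alpha,\vec n):\ \alpha_i\in\mathbb R^k,\ \|\alpha_i\|\le K,\ n_i\in\mathbb Z_{\ge1}\ (1\le i\le M),\ \sum_{i=1}^M n_i=N,\ \ \ell\lambda_k I_k\preceq \frac1N\sum_{i=1}^M n_i\alpha_i\alpha_i^\top\preceq U\lambda_1 I_k\Big\}.$$ For all constants $\rho_1,\rho_2,c_0,C_0,K,U>0$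 there are $\ell_0>0$ and $c>0$, depending only on these constants, such that the following holds for every $0<\ell\le\ell_0$. For all integers $d$, $k\ge 1$, $M$, $N\ge M$ and reals $\lambda_1\ge\lambda_k>0$ with $$k\lambda_k\le C_0,\qquad k\ge c_0\log M,\qquad d\ge(1+\rho_1)k,\qquad M\ge(1+\rho_2)k,$$ we have $$\inf_{\widehat B}\ \sup_{B\in\mathcal O^{d\times k}}\ \sup_{(\alpha,\vec n)\in\Psi_{\lambda_1,\lambda_k}}\mathbb E\big[\|\sin\Theta(\widehat B,B)\|\big]\ \ge\ c\left(\Big(\sqrt{\frac{d}{N\lambda_k}}+\sqrt{\frac{Md}{N^2\lambda_k^2}}\Big)\wedge 1\right),$$ where the infimum is over all estimators $\widehat B$ with values in $\mathcal O^{d\times k}$, i.e. (possibly randomized) measurable functions of the data $\{(x_{ij},y_{ij})\}$ and of the observed data volumes $\vec n$. -/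

import Mathlib

open MeasureTheory ProbabilityTheory
open scoped Matrix ENNReal

noncomputable section

/-- The set of real `d × k` matrices with orthonormal columns. -/
def OrthonormalMatrix (d k : ℕ) : Type :=
  {B : Matrix (Fin d) (Fin k) ℝ // Bᵀ * B = 1}

/-- The sigma-algebra generated by the matrix entries. -/
instance (d k : ℕ) : MeasurableSpace (OrthonormalMatrix d k) :=
  MeasurableSpace.comap (fun B i j => B.1 i j)
    (inferInstance : MeasurableSpace (Fin d → Fin k → ℝ))

/-- Principal angle distance: the spectral norm (operator norm on Euclidean space) of
the difference `B Bᵀ - C Cᵀ` of the two orthogonal projections. -/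
def sinThetaDist {d k : ℕ} (B C : OrthonormalMatrix d k) : ℝ :=
  ‖Matrix.toEuclideanCLM (n := Fin d) (𝕜 := ℝ) (B.1 * B.1ᵀ - C.1 * C.1ᵀ)‖

/-- The datasets of all clients: client `i` holds `n i` pairs (covariate, response). -/
abbrev Dataset (d : ℕ) {M : ℕ} (n : Fin M → ℕ) : Type :=
  (i : Fin M) → Fin (n i) → (Fin d → ℝ) × ℝ

/-- Law of one sample `(x, y)` with `y = ⟨x, θ⟩ + ξ`, where `x ∼ N(0, I_d)` and
`ξ ∼ N(0, 1)` are independent. -/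
def sampleLaw {d : ℕ} (θ : Fin d → ℝ) : Measure ((Fin d → ℝ) × ℝ) :=
  ((Measure.pi fun _ : Fin d => gaussianReal 0 1).prod (gaussianReal 0 1)).map
    fun p => (p.1, p.1 ⬝ᵥ θ + p.2)

/-- Law of the whole dataset: all samples are independent, and the regression vector of
client `i` is `θ i = B (α i)` (the covariates have identity covariance). -/
def dataLaw {d k M : ℕ} (n : Fin M → ℕ) (B : OrthonormalMatrix d k)
    (α : Fin M → EuclideanSpace ℝ (Fin k)) : Measure (Dataset d n) :=
  Measure.pi fun i => Measure.pi fun _ : Fin (n i) => sampleLaw (B.1 *ᵥ (α i).ofLp)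

/-- The client diversity matrix `(1/N) ∑ i, n i • α i (α i)ᵀ`. -/
def diversityMatrix {k M : ℕ} (N : ℕ) (α : Fin M → EuclideanSpace ℝ (Fin k))
    (n : Fin M → ℕ) : Matrix (Fin k) (Fin k) ℝ :=
  (1 / (N : ℝ)) • ∑ i, (n i : ℝ) • Matrix.vecMulVec (α i).ofLp (α i).ofLp

/-- The parameter space of pairs `(α, n)`: positive data volumes summing to `N`,
`‖α i‖ ≤ K` for all `i`, and diversity matrix between `a • 1` and `b • 1` in the
Loewner order. -/
def paramSpace (k M N : ℕ) (K a b : ℝ) :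
    Set ((Fin M → EuclideanSpace ℝ (Fin k)) × (Fin M → ℕ)) :=
  {p | (∀ i, ‖p.1 i‖ ≤ K) ∧ (∀ i, 0 < p.2 i) ∧ ∑ i, p.2 i = N ∧
    (diversityMatrix N p.1 p.2 - a • (1 : Matrix (Fin k) (Fin k) ℝ)).PosSemidef ∧
    (b • (1 : Matrix (Fin k) (Fin k) ℝ) - diversityMatrix N p.1 p.2).PosSemidef}

/-- A (possibly randomized) estimator: for every vector `n` of data volumes (which is
observed), a Markov kernel from datasets to matrices with orthonormal columns.
A measurable function of the data is the special case of a deterministic kernel. -/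
structure SubspaceEstimator (d k M : ℕ) where
  kernel : (n : Fin M → ℕ) → Kernel (Dataset d n) (OrthonormalMatrix d k)
  isMarkov : ∀ n, IsMarkovKernel (kernel n)

/-- Expected principal angle distance of an estimator at the parameter `(B, α, n)`. -/
def subspaceRisk {d k M : ℕ} (E : SubspaceEstimator d k M) (B : OrthonormalMatrix d k)
    (α : Fin M → EuclideanSpace ℝ (Fin k)) (n : Fin M → ℕ) : ℝ≥0∞ :=
  ∫⁻ D, ∫⁻ Bhat, ENNReal.ofReal (sinThetaDist Bhat B) ∂(E.kernel n D) ∂(dataLaw n B α)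

/-- Minimax risk: infimum over estimators of the supremum over all `B` and over all
`(α, n)` in the parameter space. -/
def subspaceMinimaxRisk (d k M N : ℕ) (K a b : ℝ) : ℝ≥0∞ :=
  ⨅ E : SubspaceEstimator d k M, ⨆ B : OrthonormalMatrix d k,
    ⨆ p ∈ paramSpace k M N K a b, subspaceRisk E B p.1 p.2

end

/-! ### Densities on finite products -/

section ProductMeasures

variable {ι : Type*} [Fintype ι] {E : ι → Type*} [∀ i, MeasurableSpace (E i)]

/-! The bound is Assouad's lemma applied to frames whose first column is `√(1 - δ²)` times the first
basis vector plus a tail of entries `±δ/√P`; the remaining columns are fixed basis vectors that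
avoid the tail, and `P` is the ambient dimension minus the number of columns. Every client loads on
a single axis, with coefficient `±τ i`, so only clients on the first axis see the unknown tail. The
scales `τ i` make the diversity matrix a multiple of the identity whatever the client signs are.

The client signs are independent fair coins, a prior on the nuisance coefficients. Averaging over
them makes each client's likelihood even in its regression vector. Write `γ = n i * τ i ^ 2` for the
signal of a client on the first axis. Flipping one tail entry then lowers the Hellinger affinity of
that client by at most a constant times `min γ (γ ^ 2) * δ ^ 2 / P`: the linear bound is the usual
one, while the quadratic bound comes from the symmetrization (`one_sub_le_affinity_signMixture`,
`one_sub_le_affinity_signMixture'`, transferred to the random design by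
`one_le_clientAffinity_add`).

A constant fraction of the `M` clients can be put on the first axis while every axis keeps enough
clients to respect the norm bound (`exists_group_assignment`). There `γ` is of order `N λ_k / M`,
and the total deficit stays bounded for `δ ^ 2` of order `d / (N λ_k) + M d / (N λ_k) ^ 2`, capped
at a constant. The first column of the projection dominates a sum of coordinatewise losses
(`sum_projEntry_sub_le_sinThetaDist`), so Assouad gives risk of order `δ`. -/

theorem lintegral_pi_prod_eq (μ : ∀ i, Measure (E i)) [∀ i, IsProbabilityMeasure (μ i)]
    (f : ∀ i, E i → ℝ≥0∞) (hf : ∀ i, Measurable (f i)) :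
    ∫⁻ x, ∏ i, f i (x i) ∂Measure.pi μ = ∏ i, ∫⁻ x, f i x ∂μ i := by
  rw [lintegral_prod_eq_prod_lintegral_of_indepFun Finset.univ
    (fun i (x : ∀ i, E i) => f i (x i))
    (iIndepFun_pi fun i => (hf i).aemeasurable) (fun i => (hf i).comp (measurable_pi_apply i))]
  exact Finset.prod_congr rfl fun i _ =>
    (measurePreserving_eval μ i).lintegral_comp (hf i)

theorem pi_eq_withDensity_prod (μ ν : ∀ i, Measure (E i)) [∀ i, IsProbabilityMeasure (μ i)]
    [∀ i, SigmaFinite (ν i)] (f : ∀ i, E i → ℝ≥0∞) (hf : ∀ i, Measurable (f i))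
    (hν : ∀ i, ν i = (μ i).withDensity (f i)) :
    Measure.pi ν = (Measure.pi μ).withDensity fun x => ∏ i, f i (x i) := by
  symm
  refine (Measure.pi_eq fun s hs => ?_).symm
  rw [withDensity_apply _ (MeasurableSet.univ_pi hs),
    ← lintegral_indicator (MeasurableSet.univ_pi hs)]
  have h : ∀ x : ∀ i, E i, (Set.univ.pi s).indicator (fun x => ∏ i, f i (x i)) x
      = ∏ i, (s i).indicator (f i) (x i) := by
    intro x
    by_cases hx : x ∈ Set.univ.pi s
    · rw [Set.indicator_of_mem hx]
      exact Finset.prod_congr rfl fun i _ =>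
        (Set.indicator_of_mem (hx i (Set.mem_univ i)) _).symm
    · rw [Set.indicator_of_notMem hx]
      simp only [Set.mem_pi, Set.mem_univ, true_imp_iff, not_forall] at hx
      obtain ⟨i, hi⟩ := hx
      exact (Finset.prod_eq_zero (Finset.mem_univ i) (Set.indicator_of_notMem hi _)).symm
  simp_rw [h]
  rw [lintegral_pi_prod_eq μ _ fun i => (hf i).indicator (hs i)]
  refine Finset.prod_congr rfl fun i _ => ?_
  rw [lintegral_indicator (hs i), hν i, withDensity_apply _ (hs i)]

end ProductMeasures

/-! ### Gaussian shifts and exponential moments -/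

section GaussianShift

theorem lintegral_gaussianReal_shift (c : ℝ) (g : ℝ → ℝ≥0∞) (hg : Measurable g) :
    ∫⁻ z, g (c + z) ∂gaussianReal 0 1
      = ∫⁻ y, ENNReal.ofReal (Real.exp (y * c - c ^ 2 / 2)) * g y ∂gaussianReal 0 1 := by
  have h1 : ∫⁻ z, g (c + z) ∂gaussianReal 0 1 = ∫⁻ y, g y ∂gaussianReal c 1 := by
    have := gaussianReal_map_const_add (μ := 0) (v := 1) c
    rw [zero_add] at this
    rw [← this, lintegral_map hg (measurable_const_add c)]
  rw [h1, gaussianReal_of_var_ne_zero _ one_ne_zero, gaussianReal_of_var_ne_zero _ one_ne_zero,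
    lintegral_withDensity_eq_lintegral_mul _ (measurable_gaussianPDF _ _) hg,
    lintegral_withDensity_eq_lintegral_mul _ (measurable_gaussianPDF _ _) (by fun_prop)]
  refine lintegral_congr fun y => ?_
  simp only [Pi.mul_apply]
  rw [← mul_assoc]
  congr 1
  simp only [gaussianPDF]
  rw [← ENNReal.ofReal_mul (gaussianPDFReal_nonneg _ _ _)]
  congr 1
  simp only [gaussianPDFReal, mul_assoc, ← Real.exp_add]
  congr 2
  simp only [NNReal.coe_one]
  ring_nf

/-- The standard Gaussian measure on `ι → ℝ`. -/
noncomputable abbrev stdGaussianPi (ι : Type*) [Fintype ι] : Measure (ι → ℝ) :=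
  Measure.pi fun _ : ι => gaussianReal 0 1

variable {ι : Type*} [Fintype ι]

theorem integrable_exp_dotProduct (v : ι → ℝ) :
    Integrable (fun y : ι → ℝ => Real.exp (y ⬝ᵥ v)) (stdGaussianPi ι) := by
  simp only [dotProduct, Real.exp_sum]
  refine Integrable.fintype_prod (f := fun i t => Real.exp (t * v i)) fun i => ?_
  simpa [mul_comm] using integrable_exp_mul_gaussianReal (μ := 0) (v := 1) (v i)

theorem integral_exp_dotProduct (v : ι → ℝ) :
    ∫ y, Real.exp (y ⬝ᵥ v) ∂stdGaussianPi ι = Real.exp (v ⬝ᵥ v / 2) := by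
  simp only [dotProduct, Real.exp_sum]
  rw [integral_fintype_prod_eq_prod (f := fun i t => Real.exp (t * v i)), Finset.sum_div,
    Real.exp_sum]
  refine Finset.prod_congr rfl fun i _ => ?_
  have := congrFun (mgf_fun_id_gaussianReal (μ := 0) (v := 1)) (v i)
  simp only [mgf, zero_mul, NNReal.coe_one, zero_add, one_mul] at this
  simpa [mul_comm, pow_two] using this

theorem integrable_cosh_dotProduct (v : ι → ℝ) :
    Integrable (fun y : ι → ℝ => Real.cosh (y ⬝ᵥ v)) (stdGaussianPi ι) := by
  simp only [Real.cosh_eq]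
  have h := integrable_exp_dotProduct (-v)
  simp only [dotProduct_neg] at h
  exact ((integrable_exp_dotProduct v).add h).div_const 2

theorem integral_cosh_dotProduct (v : ι → ℝ) :
    ∫ y, Real.cosh (y ⬝ᵥ v) ∂stdGaussianPi ι = Real.exp (v ⬝ᵥ v / 2) := by
  simp only [Real.cosh_eq]
  have h := integrable_exp_dotProduct (-v)
  have h' := integral_exp_dotProduct (-v)
  simp only [dotProduct_neg, neg_dotProduct, neg_neg] at h h'
  rw [integral_div, integral_add (integrable_exp_dotProduct v) h, integral_exp_dotProduct, h']
  ring

end GaussianShift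

/-! ### Likelihood ratios against the zero regression vector -/

section SampleDensity

variable {d : ℕ}

/-- The law of one sample under the null regression vector. -/
noncomputable abbrev nullLaw (d : ℕ) : Measure ((Fin d → ℝ) × ℝ) :=
  (stdGaussianPi (Fin d)).prod (gaussianReal 0 1)

/-- The likelihood ratio of one sample with respect to the null law. -/
noncomputable def sampleLik (θ : Fin d → ℝ) (p : (Fin d → ℝ) × ℝ) : ℝ :=
  Real.exp (p.2 * (p.1 ⬝ᵥ θ) - (p.1 ⬝ᵥ θ) ^ 2 / 2)

theorem measurable_dotProduct_left (θ : Fin d → ℝ) : Measurable fun x : Fin d → ℝ => x ⬝ᵥ θ := by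
  unfold dotProduct
  fun_prop

@[fun_prop]
theorem measurable_sampleLik (θ : Fin d → ℝ) : Measurable (sampleLik θ) := by
  have := measurable_dotProduct_left θ
  unfold sampleLik
  fun_prop

theorem sampleLik_pos (θ : Fin d → ℝ) (p : (Fin d → ℝ) × ℝ) : 0 < sampleLik θ p :=
  Real.exp_pos _

/-- The covariate law does not involve `θ`; for a fixed covariate only the mean of the Gaussian
response is shifted. -/
theorem sampleLaw_eq_withDensity (θ : Fin d → ℝ) :
    sampleLaw θ = (nullLaw d).withDensity fun p => ENNReal.ofReal (sampleLik θ p) := by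
  have hm := measurable_dotProduct_left θ
  refine Measure.ext_of_lintegral _ fun g hg => ?_
  unfold sampleLaw
  rw [lintegral_map hg (by fun_prop), lintegral_prod _ (by fun_prop),
    lintegral_withDensity_eq_lintegral_mul _ (by fun_prop) hg,
    lintegral_prod _ (by fun_prop)]
  refine lintegral_congr fun x => ?_
  exact lintegral_gaussianReal_shift (x ⬝ᵥ θ) (fun y => g (x, y)) (by fun_prop)

instance isProbabilityMeasure_sampleLaw (θ : Fin d → ℝ) : IsProbabilityMeasure (sampleLaw θ) := by
  have hm := measurable_dotProduct_left θ
  exact Measure.isProbabilityMeasure_map (by fun_prop)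

/-- The likelihood ratio of the data of one client. -/
noncomputable def clientLik {m : ℕ} (θ : Fin d → ℝ) (D : Fin m → (Fin d → ℝ) × ℝ) : ℝ :=
  ∏ j, sampleLik θ (D j)

@[fun_prop]
theorem measurable_clientLik {m : ℕ} (θ : Fin d → ℝ) :
    Measurable (clientLik θ : (Fin m → (Fin d → ℝ) × ℝ) → ℝ) := by
  unfold clientLik
  fun_prop

theorem clientLik_pos {m : ℕ} (θ : Fin d → ℝ) (D : Fin m → (Fin d → ℝ) × ℝ) :
    0 < clientLik θ D := Finset.prod_pos fun _ _ => sampleLik_pos _ _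

/-- The law of the data of one client under the null regression vector. -/
noncomputable abbrev clientNull (d m : ℕ) : Measure (Fin m → (Fin d → ℝ) × ℝ) :=
  Measure.pi fun _ => nullLaw d

theorem pi_sampleLaw_eq_withDensity (m : ℕ) (θ : Fin d → ℝ) :
    (Measure.pi fun _ : Fin m => sampleLaw θ)
      = (clientNull d m).withDensity fun D => ENNReal.ofReal (clientLik θ D) := by
  rw [pi_eq_withDensity_prod (fun _ : Fin m => nullLaw d) (fun _ : Fin m => sampleLaw θ)
    (fun _ p => ENNReal.ofReal (sampleLik θ p)) (fun _ => by fun_prop)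
    (fun _ => sampleLaw_eq_withDensity θ)]
  congr 1
  funext D
  exact (ENNReal.ofReal_prod_of_nonneg fun _ _ => (sampleLik_pos _ _).le).symm

theorem dataLaw_eq_withDensity {k M : ℕ} (n : Fin M → ℕ) (B : OrthonormalMatrix d k)
    (α : Fin M → EuclideanSpace ℝ (Fin k)) :
    dataLaw n B α = (Measure.pi fun i => clientNull d (n i)).withDensity
      fun D => ∏ i, ENNReal.ofReal (clientLik (B.1 *ᵥ (α i).ofLp) (D i)) :=
  pi_eq_withDensity_prod (fun i => clientNull d (n i))
    (fun i => Measure.pi fun _ : Fin (n i) => sampleLaw (B.1 *ᵥ (α i).ofLp))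
    (fun i D => ENNReal.ofReal (clientLik (B.1 *ᵥ (α i).ofLp) D)) (fun _ => by fun_prop)
    (fun i => pi_sampleLaw_eq_withDensity (n i) _)

end SampleDensity

/-! ### Affinity of symmetric Gaussian mixtures -/

section SignMixture

variable {ι : Type*} [Fintype ι]

theorem dotProduct_self_nonneg' (a : ι → ℝ) : 0 ≤ a ⬝ᵥ a :=
  Finset.sum_nonneg fun i _ => mul_self_nonneg (a i)

/-- Density of the equal mixture of `N(a, 1)` and `N(-a, 1)` with respect to `N(0, 1)`. -/
noncomputable def signMixture (a y : ι → ℝ) : ℝ :=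
  Real.exp (-(a ⬝ᵥ a) / 2) * Real.cosh (y ⬝ᵥ a)

theorem signMixture_pos (a y : ι → ℝ) : 0 < signMixture a y :=
  mul_pos (Real.exp_pos _) (Real.cosh_pos _)

theorem measurable_signMixture (a : ι → ℝ) : Measurable (signMixture a) := by
  unfold signMixture dotProduct
  fun_prop

theorem integrable_signMixture (a : ι → ℝ) : Integrable (signMixture a) (stdGaussianPi ι) :=
  (integrable_cosh_dotProduct a).const_mul _

theorem integral_signMixture (a : ι → ℝ) : ∫ y, signMixture a y ∂stdGaussianPi ι = 1 := by
  unfold signMixture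
  rw [integral_const_mul, integral_cosh_dotProduct, ← Real.exp_add]
  ring_nf
  exact Real.exp_zero

theorem signMixture_mul (a b y : ι → ℝ) :
    signMixture a y * signMixture b y = Real.exp (-(a ⬝ᵥ a + b ⬝ᵥ b) / 2) / 2 *
      (Real.cosh (y ⬝ᵥ (a + b)) + Real.cosh (y ⬝ᵥ (a - b))) := by
  unfold signMixture
  rw [dotProduct_add, dotProduct_sub, Real.cosh_add, Real.cosh_sub, neg_add, add_div,
    Real.exp_add]
  ring

theorem integrable_signMixture_mul (a b : ι → ℝ) :
    Integrable (fun y => signMixture a y * signMixture b y) (stdGaussianPi ι) := by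
  simp only [signMixture_mul]
  exact ((integrable_cosh_dotProduct _).add (integrable_cosh_dotProduct _)).const_mul _

theorem integral_signMixture_mul (a b : ι → ℝ) :
    ∫ y, signMixture a y * signMixture b y ∂stdGaussianPi ι = Real.cosh (a ⬝ᵥ b) := by
  simp only [signMixture_mul]
  rw [integral_const_mul, integral_add (integrable_cosh_dotProduct _)
    (integrable_cosh_dotProduct _), integral_cosh_dotProduct, integral_cosh_dotProduct,
    Real.cosh_eq, mul_add, div_mul_eq_mul_div, div_mul_eq_mul_div, ← Real.exp_add,
    ← Real.exp_add, ← add_div]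
  have hab : b ⬝ᵥ a = a ⬝ᵥ b := dotProduct_comm _ _
  congr 3 <;>
  · simp only [dotProduct_add, add_dotProduct, dotProduct_sub, sub_dotProduct, hab]
    ring

theorem integrable_sqrt_signMixture_mul (a b : ι → ℝ) :
    Integrable (fun y => √(signMixture a y * signMixture b y)) (stdGaussianPi ι) := by
  refine ((integrable_signMixture a).add (integrable_signMixture b)).mono'
    ((measurable_signMixture a).mul (measurable_signMixture b)).sqrt.aestronglyMeasurable
    (Filter.Eventually.of_forall fun y => ?_)
  have ha := signMixture_pos a y
  have hb := signMixture_pos b y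
  rw [Real.norm_of_nonneg (Real.sqrt_nonneg _)]
  refine Real.sqrt_le_iff.2 ⟨by simp only [Pi.add_apply]; positivity, ?_⟩
  simp only [Pi.add_apply]
  nlinarith [mul_pos ha hb]

/-- In the product formula, bound `cosh (y ⬝ᵥ (a - b))` below by `1`; the half-angle identity turns
what remains into a perfect square, whose root integrates to `exp (-|a - b|² / 8)`. -/
theorem one_sub_le_affinity_signMixture (a b : ι → ℝ) :
    1 - (a - b) ⬝ᵥ (a - b) / 8 ≤ ∫ y, √(signMixture a y * signMixture b y) ∂stdGaussianPi ι := by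
  have hc : ∀ y, Real.exp (-(a ⬝ᵥ a + b ⬝ᵥ b) / 4) * Real.cosh (y ⬝ᵥ ((1 / 2 : ℝ) • (a + b)))
      ≤ √(signMixture a y * signMixture b y) := by
    intro y
    refine Real.le_sqrt_of_sq_le ?_
    rw [signMixture_mul, dotProduct_smul, smul_eq_mul]
    have h1 : Real.exp (-(a ⬝ᵥ a + b ⬝ᵥ b) / 4) ^ 2 = Real.exp (-(a ⬝ᵥ a + b ⬝ᵥ b) / 2) := by
      rw [← Real.exp_nat_mul]; congr 1; push_cast; ring
    have h2 := Real.cosh_two_mul (1 / 2 * (y ⬝ᵥ (a + b)))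
    have h3 := Real.cosh_sq (1 / 2 * (y ⬝ᵥ (a + b)))
    have h4 := Real.one_le_cosh (y ⬝ᵥ (a - b))
    have h5 : 2 * (1 / 2 * (y ⬝ᵥ (a + b))) = y ⬝ᵥ (a + b) := by ring
    rw [h5] at h2
    rw [mul_pow, h1]
    have h6 := Real.exp_pos (-(a ⬝ᵥ a + b ⬝ᵥ b) / 2)
    nlinarith
  have hi := integral_mono ((integrable_cosh_dotProduct ((1 / 2 : ℝ) • (a + b))).const_mul _)
    (integrable_sqrt_signMixture_mul a b) hc
  rw [integral_const_mul, integral_cosh_dotProduct, ← Real.exp_add] at hi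
  refine le_trans ?_ hi
  refine le_trans (le_of_eq ?_) (Real.add_one_le_exp _)
  have hab : b ⬝ᵥ a = a ⬝ᵥ b := dotProduct_comm _ _
  simp only [dotProduct_add, add_dotProduct, dotProduct_sub, sub_dotProduct, hab,
    dotProduct_smul, smul_dotProduct, smul_eq_mul]
  ring

theorem cosh_sub_one_le_sq {u : ℝ} (hu : |u| ≤ 1) : Real.cosh u ≤ 1 + u ^ 2 := by
  have h1 := Real.abs_exp_sub_one_sub_id_le hu
  have h2 := Real.abs_exp_sub_one_sub_id_le (x := -u) (by rwa [abs_neg])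
  rw [abs_le] at h1 h2
  rw [Real.cosh_eq]
  nlinarith

theorem sinh_le_two_mul {u : ℝ} (h0 : 0 ≤ u) (hu : u ≤ 1) : Real.sinh u ≤ 2 * u := by
  have hu' : |u| ≤ 1 := by rwa [abs_of_nonneg h0]
  have h1 := Real.abs_exp_sub_one_sub_id_le hu'
  have h2 := Real.abs_exp_sub_one_sub_id_le (x := -u) (by rwa [abs_neg])
  rw [abs_le] at h1 h2
  rw [Real.sinh_eq]
  nlinarith

/-- The left side is the `L²` distance between the two mixture densities. Sum-to-product formulas
split it into a term in `|a|² - |b|² = (a - b) ⬝ᵥ (a + b)`, handled by Cauchy–Schwarz, and a term in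
`(|a|² + |b|²) / 2 - a ⬝ᵥ b = |a - b|² / 2`. -/
theorem cosh_add_cosh_sub_le (a b : ι → ℝ) (ha : a ⬝ᵥ a ≤ 1) (hb : b ⬝ᵥ b ≤ 1) :
    Real.cosh (a ⬝ᵥ a) + Real.cosh (b ⬝ᵥ b) - 2 * Real.cosh (a ⬝ᵥ b)
      ≤ 4 * ((a - b) ⬝ᵥ (a - b) * (a ⬝ᵥ a + b ⬝ᵥ b)) := by
  have hab : b ⬝ᵥ a = a ⬝ᵥ b := dotProduct_comm _ _
  have hm := dotProduct_self_nonneg' (a - b)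
  have hp := dotProduct_self_nonneg' (a + b)
  have hcs : ((a - b) ⬝ᵥ (a + b)) ^ 2 ≤ ((a - b) ⬝ᵥ (a - b)) * ((a + b) ⬝ᵥ (a + b)) := by
    simp only [dotProduct]
    have := Finset.sum_mul_sq_le_sq_mul_sq Finset.univ (a - b) (a + b)
    simpa only [pow_two] using this
  have ha0 := dotProduct_self_nonneg' a
  have hb0 := dotProduct_self_nonneg' b
  simp only [dotProduct_add, add_dotProduct, dotProduct_sub, sub_dotProduct, hab] at *
  generalize a ⬝ᵥ a = S at *
  generalize b ⬝ᵥ b = T at *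
  generalize a ⬝ᵥ b = R at *
  have e1 : Real.cosh S + Real.cosh T = 2 * Real.cosh ((S + T) / 2) * Real.cosh ((S - T) / 2) := by
    have h1 := Real.cosh_add ((S + T) / 2) ((S - T) / 2)
    have h2 := Real.cosh_sub ((S + T) / 2) ((S - T) / 2)
    rw [show (S + T) / 2 + (S - T) / 2 = S by ring] at h1
    rw [show (S + T) / 2 - (S - T) / 2 = T by ring] at h2
    rw [h1, h2]; ring
  have e2 : Real.cosh ((S + T) / 2) - Real.cosh R
      = 2 * (Real.sinh (((S + T) / 2 + R) / 2) * Real.sinh (((S + T) / 2 - R) / 2)) := by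
    have h1 := Real.cosh_add (((S + T) / 2 + R) / 2) (((S + T) / 2 - R) / 2)
    have h2 := Real.cosh_sub (((S + T) / 2 + R) / 2) (((S + T) / 2 - R) / 2)
    rw [show ((S + T) / 2 + R) / 2 + ((S + T) / 2 - R) / 2 = (S + T) / 2 by ring] at h1
    rw [show ((S + T) / 2 + R) / 2 - ((S + T) / 2 - R) / 2 = R by ring] at h2
    rw [h1, h2]; ring
  have c1 : Real.cosh ((S - T) / 2) ≤ 1 + ((S - T) / 2) ^ 2 :=
    cosh_sub_one_le_sq (abs_le.2 ⟨by linarith, by linarith⟩)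
  have c2 : Real.cosh ((S + T) / 2) ≤ 2 := by
    have := cosh_sub_one_le_sq (u := (S + T) / 2) (abs_le.2 ⟨by linarith, by linarith⟩)
    nlinarith
  have c2' := Real.one_le_cosh ((S + T) / 2)
  have c3 := sinh_le_two_mul (u := ((S + T) / 2 + R) / 2) (by linarith) (by linarith)
  have c4 := sinh_le_two_mul (u := ((S + T) / 2 - R) / 2) (by linarith) (by linarith)
  have c4' : 0 ≤ Real.sinh (((S + T) / 2 - R) / 2) := Real.sinh_nonneg_iff.2 (by linarith)
  have c5 : Real.sinh (((S + T) / 2 + R) / 2) * Real.sinh (((S + T) / 2 - R) / 2)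
      ≤ (2 * (((S + T) / 2 + R) / 2)) * (2 * (((S + T) / 2 - R) / 2)) :=
    mul_le_mul c3 c4 c4' (by linarith)
  have c6 : Real.cosh ((S + T) / 2) * (Real.cosh ((S - T) / 2) - 1) ≤ 2 * ((S - T) / 2) ^ 2 :=
    mul_le_mul c2 (by linarith) (by linarith [Real.one_le_cosh ((S - T) / 2)]) (by norm_num)
  have c7 : (S - T) ^ 2 ≤ 2 * ((S - R - (R - T)) * (S + T)) := by
    have h : (S - R - (R - T)) * (S + R + (R + T)) ≤ (S - R - (R - T)) * (2 * (S + T)) :=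
      mul_le_mul_of_nonneg_left (by linarith) hm
    have h' : (S - R + (R - T)) ^ 2 = (S - T) ^ 2 := by ring
    nlinarith
  have c8 : (2 * (((S + T) / 2 + R) / 2)) * (2 * (((S + T) / 2 - R) / 2))
      ≤ (S + T) * ((S - R - (R - T)) / 2) := by
    refine mul_le_mul (by linarith) (by linarith) (by linarith) (by linarith)
  nlinarith

/-- This is the gain from random signs: the extra factor `|a|² + |b|²` makes weak signals
quadratically less informative. In the unit ball both densities are at least `1/2`, so the Hellinger
distance is controlled by the `L²` distance. -/
theorem one_sub_le_affinity_signMixture' (a b : ι → ℝ) :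
    1 - (a - b) ⬝ᵥ (a - b) * (a ⬝ᵥ a + b ⬝ᵥ b)
      ≤ ∫ y, √(signMixture a y * signMixture b y) ∂stdGaussianPi ι := by
  have hm := dotProduct_self_nonneg' (a - b)
  have ha0 := dotProduct_self_nonneg' a
  have hb0 := dotProduct_self_nonneg' b
  by_cases h : a ⬝ᵥ a ≤ 1 ∧ b ⬝ᵥ b ≤ 1
  · have half_le : ∀ (c : ι → ℝ), c ⬝ᵥ c ≤ 1 → ∀ y, 1 / 2 ≤ signMixture c y := by
      intro c hc y
      have h1 : (1 / 2 : ℝ) ≤ Real.exp (-(c ⬝ᵥ c) / 2) := by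
        have := Real.add_one_le_exp (-(c ⬝ᵥ c) / 2)
        linarith
      have h2 := Real.one_le_cosh (y ⬝ᵥ c)
      unfold signMixture
      nlinarith
    -- With densities `p, q ≥ 1/2`: `√(pq) = (p + q)/2 - (√p - √q)²/2`, and `(√p - √q)² = (p -
    -- q)²/(√p + √q)² ≤ (p - q)²/2`.
    have hpt : ∀ y, (signMixture a y + signMixture b y) / 2
        - (signMixture a y * signMixture a y + signMixture b y * signMixture b y
          - 2 * (signMixture a y * signMixture b y)) / 4
        ≤ √(signMixture a y * signMixture b y) := by
      intro y
      have h1 := half_le a h.1 y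
      have h2 := half_le b h.2 y
      generalize signMixture a y = p at *
      generalize signMixture b y = q at *
      rw [Real.sqrt_mul (by linarith)]
      have hp := Real.sq_sqrt (show 0 ≤ p by linarith)
      have hq := Real.sq_sqrt (show 0 ≤ q by linarith)
      have hp0 := Real.sqrt_nonneg p
      have hq0 := Real.sqrt_nonneg q
      have hpq : 1 / 2 ≤ √p * √q := by
        rw [← Real.sqrt_mul (by linarith)]
        exact Real.le_sqrt_of_sq_le (by nlinarith)
      have h3 : 2 ≤ (√p + √q) ^ 2 := by nlinarith
      have h4 := mul_le_mul_of_nonneg_left h3 (sq_nonneg (√p - √q))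
      have h5 : (√p - √q) ^ 2 * (√p + √q) ^ 2 = (p - q) ^ 2 := by
        rw [← mul_pow, show (√p - √q) * (√p + √q) = √p ^ 2 - √q ^ 2 by ring, hp, hq]
      nlinarith
    have ia := integrable_signMixture a
    have ib := integrable_signMixture b
    have iaa := integrable_signMixture_mul a a
    have ibb := integrable_signMixture_mul b b
    have iab := (integrable_signMixture_mul a b).const_mul 2
    have is : Integrable (fun y => signMixture a y + signMixture b y) (stdGaussianPi ι) :=
      ia.add ib
    have iq : Integrable (fun y => signMixture a y * signMixture a y
        + signMixture b y * signMixture b y) (stdGaussianPi ι) := iaa.add ibb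
    have iv : Integrable (fun y => signMixture a y * signMixture a y
        + signMixture b y * signMixture b y - 2 * (signMixture a y * signMixture b y))
        (stdGaussianPi ι) := iq.sub iab
    have hi := integral_mono ((is.div_const 2).sub (iv.div_const 4))
      (integrable_sqrt_signMixture_mul a b) hpt
    simp only [Pi.sub_apply] at hi
    rw [integral_sub (is.div_const 2) (iv.div_const 4), integral_div, integral_div,
      integral_sub iq iab, integral_const_mul, integral_add ia ib, integral_add iaa ibb,
      integral_signMixture, integral_signMixture, integral_signMixture_mul,
      integral_signMixture_mul, integral_signMixture_mul] at hi
    have := cosh_add_cosh_sub_le a b h.1 h.2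
    linarith
  -- Outside the unit ball the extra factor is at least `1`, so the linear bound is already
  -- stronger.
  · refine le_trans ?_ (one_sub_le_affinity_signMixture a b)
    have : 1 ≤ a ⬝ᵥ a + b ⬝ᵥ b := by
      rw [not_and_or, not_le, not_le] at h
      rcases h with h | h <;> linarith
    nlinarith

theorem one_le_lintegral_affinity_signMixture (a b : ι → ℝ) :
    1 ≤ (∫⁻ y, ENNReal.ofReal √(signMixture a y * signMixture b y) ∂stdGaussianPi ι)
      + ENNReal.ofReal ((a - b) ⬝ᵥ (a - b)) ∧
    1 ≤ (∫⁻ y, ENNReal.ofReal √(signMixture a y * signMixture b y) ∂stdGaussianPi ι)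
      + ENNReal.ofReal ((a - b) ⬝ᵥ (a - b) * (a ⬝ᵥ a + b ⬝ᵥ b)) := by
  have hm := dotProduct_self_nonneg' (a - b)
  have ha0 := dotProduct_self_nonneg' a
  have hb0 := dotProduct_self_nonneg' b
  rw [← ofReal_integral_eq_lintegral_ofReal (integrable_sqrt_signMixture_mul a b)
    (Filter.Eventually.of_forall fun _ => Real.sqrt_nonneg _),
    ← ENNReal.ofReal_add (integral_nonneg fun _ => Real.sqrt_nonneg _) hm,
    ← ENNReal.ofReal_add (integral_nonneg fun _ => Real.sqrt_nonneg _) (by positivity),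
    ENNReal.one_le_ofReal, ENNReal.one_le_ofReal]
  have h1 := one_sub_le_affinity_signMixture a b
  have h2 := one_sub_le_affinity_signMixture' a b
  constructor <;> linarith

end SignMixture

/-! ### Second and fourth moments of the Gaussian design -/

section Moments

/-- Powers are majorized by `cosh` so that the exponential moments already computed serve for all
moments, at the price of non-optimal constants. -/
theorem sq_le_two_mul_cosh (t : ℝ) : t ^ 2 ≤ 2 * Real.cosh t := by
  have h1 := Real.cosh_two_mul (t / 2)
  have h2 := Real.cosh_sq (t / 2)
  rw [mul_div_cancel₀ t two_ne_zero] at h1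
  have h3 : (t / 2) ^ 2 ≤ Real.sinh (t / 2) ^ 2 := by
    rw [sq_le_sq]
    rcases le_total 0 (t / 2) with h | h
    · rw [abs_of_nonneg h, abs_of_nonneg (Real.sinh_nonneg_iff.2 h)]
      exact Real.self_le_sinh_iff.2 h
    · rw [abs_of_nonpos h, abs_of_nonpos (Real.sinh_nonpos_iff.2 h)]
      exact neg_le_neg (Real.sinh_le_self_iff.2 h)
  nlinarith

theorem pow_four_le_mul_cosh (t : ℝ) : t ^ 4 ≤ 64 * Real.cosh t := by
  have h1 := Real.cosh_two_mul (t / 2)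
  have h2 := Real.cosh_sq (t / 2)
  rw [mul_div_cancel₀ t two_ne_zero] at h1
  have h3 := sq_le_two_mul_cosh (t / 2)
  have h4 : ((t / 2) ^ 2) ^ 2 ≤ (2 * Real.cosh (t / 2)) ^ 2 :=
    pow_le_pow_left₀ (sq_nonneg _) h3 2
  have h5 := sq_nonneg (Real.sinh (t / 2))
  have h6 := Real.one_le_cosh (t / 2)
  have h7 := Real.one_le_cosh t
  nlinarith


variable {ι κ : Type*} [Fintype ι] [Fintype κ]

/-- Scaling out the length lets the `cosh` bounds be used only for vectors in the unit ball, where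
their expectation is at most `2`. The inequality, rather than a unit norm, covers `v = 0`. -/
theorem exists_normalized (v : ι → ℝ) : ∃ u : ι → ℝ, u ⬝ᵥ u ≤ 1 ∧ v = √(v ⬝ᵥ v) • u := by
  have h0 := dotProduct_self_nonneg' v
  rcases h0.eq_or_lt with h | h
  · refine ⟨0, by simp, ?_⟩
    rw [smul_zero]
    exact dotProduct_self_eq_zero.1 h.symm
  · have hs := Real.sqrt_pos.2 h
    refine ⟨(√(v ⬝ᵥ v))⁻¹ • v, le_of_eq ?_, ?_⟩
    · rw [smul_dotProduct, dotProduct_smul, smul_eq_mul, smul_eq_mul, ← mul_assoc,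
        ← mul_inv, Real.mul_self_sqrt h0, inv_mul_cancel₀ h.ne']
    · rw [smul_smul, mul_inv_cancel₀ hs.ne', one_smul]

theorem lintegral_cosh_dotProduct_le (u : ι → ℝ) (hu : u ⬝ᵥ u ≤ 1) :
    ∫⁻ x, ENNReal.ofReal (Real.cosh (x ⬝ᵥ u)) ∂stdGaussianPi ι ≤ 2 := by
  rw [← ofReal_integral_eq_lintegral_ofReal (integrable_cosh_dotProduct u)
    (Filter.Eventually.of_forall fun _ => (Real.cosh_pos _).le), integral_cosh_dotProduct]
  refine ENNReal.ofReal_le_of_le_toReal ?_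
  rw [ENNReal.toReal_ofNat]
  have h1 : Real.exp (u ⬝ᵥ u / 2) ≤ Real.exp (1 / 2) := Real.exp_le_exp.2 (by linarith)
  have h2 : Real.exp (1 / 2) ^ 2 = Real.exp 1 := by
    rw [← Real.exp_nat_mul]; norm_num
  have h3 := Real.exp_one_lt_d9
  nlinarith [Real.exp_pos (1 / 2)]

/-- The law of a matrix with independent standard Gaussian entries. -/
noncomputable abbrev gaussianDesign (κ ι : Type*) [Fintype κ] [Fintype ι] :
    Measure (κ → ι → ℝ) :=
  Measure.pi fun _ : κ => stdGaussianPi ι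

theorem measurable_cosh_dotProduct (u : ι → ℝ) :
    Measurable fun x : ι → ℝ => Real.cosh (x ⬝ᵥ u) := by
  unfold dotProduct
  fun_prop

theorem lintegral_sum_cosh_le (u : ι → ℝ) (hu : u ⬝ᵥ u ≤ 1) :
    ∫⁻ X, ENNReal.ofReal (∑ j, Real.cosh (X j ⬝ᵥ u)) ∂gaussianDesign κ ι
      ≤ ENNReal.ofReal (2 * Fintype.card κ) := by
  have hm := measurable_cosh_dotProduct u
  simp_rw [ENNReal.ofReal_sum_of_nonneg fun j (_ : j ∈ Finset.univ) =>
    (Real.cosh_pos ((_ : κ → ι → ℝ) j ⬝ᵥ u)).le]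
  rw [lintegral_finsetSum _ fun j _ => by fun_prop]
  have h : ∀ j : κ, ∫⁻ X, ENNReal.ofReal (Real.cosh (X j ⬝ᵥ u)) ∂gaussianDesign κ ι ≤ 2 := by
    intro j
    have := (measurePreserving_eval (fun _ : κ => stdGaussianPi ι) j).lintegral_comp
      (f := fun x => ENNReal.ofReal (Real.cosh (x ⬝ᵥ u))) (by fun_prop)
    exact this.trans_le (lintegral_cosh_dotProduct_le u hu)
  refine (Finset.sum_le_sum fun j _ => h j).trans (le_of_eq ?_)
  rw [Finset.sum_const, Finset.card_univ, nsmul_eq_mul, mul_comm,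
    ENNReal.ofReal_mul two_pos.le, ENNReal.ofReal_ofNat, ENNReal.ofReal_natCast]

theorem sum_sq_dotProduct_le (X : κ → ι → ℝ) (r : ℝ) (u : ι → ℝ) :
    ∑ j, (X j ⬝ᵥ (r • u)) ^ 2 ≤ r ^ 2 * 2 * ∑ j, Real.cosh (X j ⬝ᵥ u) := by
  rw [Finset.mul_sum]
  refine Finset.sum_le_sum fun j _ => ?_
  rw [dotProduct_smul, smul_eq_mul, mul_pow, mul_assoc]
  exact mul_le_mul_of_nonneg_left (sq_le_two_mul_cosh _) (sq_nonneg _)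

theorem sum_sq_mul_sum_sq_dotProduct_le (X : κ → ι → ℝ) (r s : ℝ) (u v : ι → ℝ) :
    (∑ j, (X j ⬝ᵥ (r • u)) ^ 2) * (∑ j, (X j ⬝ᵥ (s • v)) ^ 2)
      ≤ r ^ 2 * s ^ 2 * 32 * Fintype.card κ *
        (∑ j, Real.cosh (X j ⬝ᵥ u) + ∑ j, Real.cosh (X j ⬝ᵥ v)) := by
  rw [Finset.sum_mul_sum]
  have h : ∀ i j : κ, (X i ⬝ᵥ (r • u)) ^ 2 * (X j ⬝ᵥ (s • v)) ^ 2
      ≤ r ^ 2 * s ^ 2 * 32 * (Real.cosh (X i ⬝ᵥ u) + Real.cosh (X j ⬝ᵥ v)) := by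
    intro i j
    simp only [dotProduct_smul, smul_eq_mul, mul_pow]
    have h1 := pow_four_le_mul_cosh (X i ⬝ᵥ u)
    have h2 := pow_four_le_mul_cosh (X j ⬝ᵥ v)
    have h3 : (X i ⬝ᵥ u) ^ 2 * (X j ⬝ᵥ v) ^ 2
        ≤ 32 * (Real.cosh (X i ⬝ᵥ u) + Real.cosh (X j ⬝ᵥ v)) := by
      nlinarith [sq_nonneg ((X i ⬝ᵥ u) ^ 2 - (X j ⬝ᵥ v) ^ 2)]
    have h4 := mul_le_mul_of_nonneg_left h3 (mul_nonneg (sq_nonneg r) (sq_nonneg s))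
    linarith
  refine (Finset.sum_le_sum fun i _ => Finset.sum_le_sum fun j _ => h i j).trans (le_of_eq ?_)
  simp only [← Finset.mul_sum, Finset.sum_add_distrib, Finset.sum_const, Finset.card_univ,
    nsmul_eq_mul]
  ring

theorem lintegral_sum_sq_dotProduct_le (η : ι → ℝ) :
    ∫⁻ X, ENNReal.ofReal (∑ j, (X j ⬝ᵥ η) ^ 2) ∂gaussianDesign κ ι
      ≤ ENNReal.ofReal (4 * Fintype.card κ * (η ⬝ᵥ η)) := by
  obtain ⟨u, hu, hη⟩ := exists_normalized η
  have h0 := dotProduct_self_nonneg' η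
  have hm := measurable_cosh_dotProduct u
  set r := √(η ⬝ᵥ η) with hr
  have hr2 : r ^ 2 = η ⬝ᵥ η := Real.sq_sqrt h0
  rw [← hr2]
  conv_lhs => rw [hη]
  refine (lintegral_mono fun X => ENNReal.ofReal_le_ofReal (sum_sq_dotProduct_le X r u)).trans ?_
  simp_rw [ENNReal.ofReal_mul (show 0 ≤ r ^ 2 * 2 by positivity)]
  rw [lintegral_const_mul _ (by fun_prop)]
  refine (mul_le_mul_right (lintegral_sum_cosh_le u hu) _).trans (le_of_eq ?_)
  rw [← ENNReal.ofReal_mul (by positivity)]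
  congr 1
  ring

theorem lintegral_sum_sq_mul_sum_sq_le (η θ : ι → ℝ) :
    ∫⁻ X, ENNReal.ofReal ((∑ j, (X j ⬝ᵥ η) ^ 2) * ∑ j, (X j ⬝ᵥ θ) ^ 2) ∂gaussianDesign κ ι
      ≤ ENNReal.ofReal (128 * (Fintype.card κ : ℝ) ^ 2 * ((η ⬝ᵥ η) * (θ ⬝ᵥ θ))) := by
  obtain ⟨u, hu, hη⟩ := exists_normalized η
  obtain ⟨v, hv, hθ⟩ := exists_normalized θ
  have hm := measurable_cosh_dotProduct u
  have hm' := measurable_cosh_dotProduct v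
  set r := √(η ⬝ᵥ η) with hr
  set s := √(θ ⬝ᵥ θ) with hs
  have hr2 : r ^ 2 = η ⬝ᵥ η := Real.sq_sqrt (dotProduct_self_nonneg' η)
  have hs2 : s ^ 2 = θ ⬝ᵥ θ := Real.sq_sqrt (dotProduct_self_nonneg' θ)
  rw [← hr2, ← hs2]
  conv_lhs => rw [hη, hθ]
  refine (lintegral_mono fun X => ENNReal.ofReal_le_ofReal
    (sum_sq_mul_sum_sq_dotProduct_le X r s u v)).trans ?_
  simp_rw [ENNReal.ofReal_mul (show 0 ≤ r ^ 2 * s ^ 2 * 32 * (Fintype.card κ : ℝ) by positivity)]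
  rw [lintegral_const_mul _ (by fun_prop)]
  have hadd : ∀ X : κ → ι → ℝ,
      ENNReal.ofReal (∑ j, Real.cosh (X j ⬝ᵥ u) + ∑ j, Real.cosh (X j ⬝ᵥ v))
        = ENNReal.ofReal (∑ j, Real.cosh (X j ⬝ᵥ u)) + ENNReal.ofReal (∑ j, Real.cosh (X j ⬝ᵥ v)) :=
    fun X => ENNReal.ofReal_add (Finset.sum_nonneg fun _ _ => (Real.cosh_pos _).le)
      (Finset.sum_nonneg fun _ _ => (Real.cosh_pos _).le)
  simp_rw [hadd]
  rw [lintegral_add_left (by fun_prop)]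
  refine (mul_le_mul_right (add_le_add (lintegral_sum_cosh_le u hu)
    (lintegral_sum_cosh_le v hv)) _).trans (le_of_eq ?_)
  rw [← ENNReal.ofReal_add (by positivity) (by positivity), ← ENNReal.ofReal_mul (by positivity)]
  congr 1
  ring

end Moments

/-! ### Affinity of two symmetrized clients -/

section ClientAffinity

variable {d m : ℕ}

/-- The likelihood ratio of one client when its regression vector is `±θ` with equal odds. -/
noncomputable def clientMix (θ : Fin d → ℝ) (D : Fin m → (Fin d → ℝ) × ℝ) : ℝ :=
  (clientLik θ D + clientLik (-θ) D) / 2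

@[fun_prop]
theorem measurable_clientMix (θ : Fin d → ℝ) :
    Measurable (clientMix θ : (Fin m → (Fin d → ℝ) × ℝ) → ℝ) := by
  unfold clientMix
  fun_prop

theorem clientMix_pos (θ : Fin d → ℝ) (D : Fin m → (Fin d → ℝ) × ℝ) : 0 < clientMix θ D :=
  half_pos (add_pos (clientLik_pos _ _) (clientLik_pos _ _))

theorem clientLik_eq_exp (θ : Fin d → ℝ) (D : Fin m → (Fin d → ℝ) × ℝ) :
    clientLik θ D = Real.exp ((fun j => (D j).2) ⬝ᵥ (fun j => (D j).1 ⬝ᵥ θ)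
      - (fun j => (D j).1 ⬝ᵥ θ) ⬝ᵥ (fun j => (D j).1 ⬝ᵥ θ) / 2) := by
  unfold clientLik sampleLik
  rw [← Real.exp_sum, Finset.sum_sub_distrib]
  simp only [dotProduct, Finset.sum_div, pow_two]

theorem clientMix_eq_signMixture (θ : Fin d → ℝ) (D : Fin m → (Fin d → ℝ) × ℝ) :
    clientMix θ D = signMixture (fun j => (D j).1 ⬝ᵥ θ) (fun j => (D j).2) := by
  unfold clientMix signMixture
  rw [clientLik_eq_exp, clientLik_eq_exp]
  have h : (fun j => (D j).1 ⬝ᵥ (-θ)) = -(fun j => (D j).1 ⬝ᵥ θ) := by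
    funext j; simp
  rw [h, dotProduct_neg, dotProduct_neg, neg_dotProduct, neg_neg, Real.cosh_eq, neg_div,
    sub_eq_add_neg, sub_eq_add_neg, Real.exp_add, Real.exp_add]
  ring

theorem lintegral_clientMix (θ : Fin d → ℝ) :
    ∫⁻ D, ENNReal.ofReal (clientMix θ D) ∂clientNull d m = 1 := by
  have h1 : ∀ η : Fin d → ℝ, ∫⁻ D, ENNReal.ofReal (clientLik η D) ∂clientNull d m = 1 := by
    intro η
    have := congrArg (fun μ => μ Set.univ) (pi_sampleLaw_eq_withDensity m η)
    simpa using this.symm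
  have h2 : ∀ D : Fin m → (Fin d → ℝ) × ℝ, ENNReal.ofReal (clientMix θ D)
      = (ENNReal.ofReal (clientLik θ D) + ENNReal.ofReal (clientLik (-θ) D)) * 2⁻¹ := by
    intro D
    rw [clientMix, ENNReal.ofReal_div_of_pos two_pos, ENNReal.ofReal_add (clientLik_pos _ _).le
      (clientLik_pos _ _).le, ENNReal.ofReal_ofNat, div_eq_mul_inv]
  simp_rw [h2]
  rw [lintegral_mul_const _ (by fun_prop), lintegral_add_left (by fun_prop), h1, h1,
    one_add_one_eq_two, ENNReal.mul_inv_cancel two_ne_zero ENNReal.ofNat_ne_top]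

/-- The Hellinger affinity between two symmetrized client laws. -/
noncomputable def clientAffinity (m : ℕ) (θ θ' : Fin d → ℝ) : ℝ≥0∞ :=
  ∫⁻ D, ENNReal.ofReal √(clientMix θ D * clientMix θ' D) ∂clientNull d m

theorem clientAffinity_self (θ : Fin d → ℝ) : clientAffinity m θ θ = 1 := by
  unfold clientAffinity
  simp_rw [Real.sqrt_mul_self (clientMix_pos θ _).le]
  exact lintegral_clientMix θ

/-- Conditioning on the design `X` reduces a client to a sign mixture with means `±Xθ`. -/
theorem clientAffinity_eq (θ θ' : Fin d → ℝ) :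
    clientAffinity m θ θ' = ∫⁻ X, ∫⁻ y, ENNReal.ofReal
      √(signMixture (fun j => X j ⬝ᵥ θ) y * signMixture (fun j => X j ⬝ᵥ θ') y)
        ∂stdGaussianPi (Fin m) ∂gaussianDesign (Fin m) (Fin d) := by
  have hm : Measurable fun p : (Fin m → Fin d → ℝ) × (Fin m → ℝ) => ENNReal.ofReal
      √(signMixture (fun j => p.1 j ⬝ᵥ θ) p.2 * signMixture (fun j => p.1 j ⬝ᵥ θ') p.2) := by
    unfold signMixture dotProduct
    fun_prop
  rw [← lintegral_prod _ hm.aemeasurable]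
  unfold clientAffinity
  rw [← (measurePreserving_arrowProdEquivProdArrow (Fin d → ℝ) ℝ (Fin m)
    (fun _ => stdGaussianPi (Fin d)) (fun _ => gaussianReal 0 1)).lintegral_comp hm]
  refine lintegral_congr fun D => ?_
  rw [clientMix_eq_signMixture, clientMix_eq_signMixture]
  rfl

/-- Average the two conditional bounds over the design. The additive form avoids truncated
subtraction in `ℝ≥0∞`. -/
theorem one_le_clientAffinity_add (θ θ' : Fin d → ℝ) :
    1 ≤ clientAffinity m θ θ' + ENNReal.ofReal (4 * m * ((θ - θ') ⬝ᵥ (θ - θ'))) ∧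
    1 ≤ clientAffinity m θ θ' + ENNReal.ofReal
      (128 * (m : ℝ) ^ 2 * ((θ - θ') ⬝ᵥ (θ - θ')) * (θ ⬝ᵥ θ + θ' ⬝ᵥ θ')) := by
  have hsub : ∀ X : Fin m → Fin d → ℝ,
      (fun j => X j ⬝ᵥ θ) - (fun j => X j ⬝ᵥ θ') = fun j => X j ⬝ᵥ (θ - θ') := by
    intro X; funext j; simp [dotProduct_sub]
  have hsq : ∀ (X : Fin m → Fin d → ℝ) (η : Fin d → ℝ),
      (fun j => X j ⬝ᵥ η) ⬝ᵥ (fun j => X j ⬝ᵥ η) = ∑ j, (X j ⬝ᵥ η) ^ 2 := by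
    intro X η; simp [dotProduct, pow_two]
  have hm : ∀ η : Fin d → ℝ, Measurable fun X : Fin m → Fin d → ℝ => ∑ j, (X j ⬝ᵥ η) ^ 2 := by
    intro η; unfold dotProduct; fun_prop
  have h0 := dotProduct_self_nonneg' (θ - θ')
  have h1 := dotProduct_self_nonneg' θ
  have h2 := dotProduct_self_nonneg' θ'
  have key := fun X : Fin m → Fin d → ℝ => one_le_lintegral_affinity_signMixture
    (fun j => X j ⬝ᵥ θ) (fun j => X j ⬝ᵥ θ')
  simp only [hsub, hsq] at key
  have hone : ∫⁻ _ : Fin m → Fin d → ℝ, 1 ∂gaussianDesign (Fin m) (Fin d) = 1 := by simp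
  rw [clientAffinity_eq]
  constructor
  · have h := lintegral_mono (μ := gaussianDesign (Fin m) (Fin d)) fun X => (key X).1
    rw [hone, lintegral_add_right _ (by fun_prop)] at h
    refine h.trans (add_le_add le_rfl ?_)
    simpa using lintegral_sum_sq_dotProduct_le (κ := Fin m) (θ - θ')
  · have h := lintegral_mono (μ := gaussianDesign (Fin m) (Fin d)) fun X => (key X).2
    rw [hone, lintegral_add_right _ (by fun_prop)] at h
    refine h.trans (add_le_add le_rfl ?_)
    have hadd : ∀ X : Fin m → Fin d → ℝ, ENNReal.ofReal ((∑ j, (X j ⬝ᵥ (θ - θ')) ^ 2) *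
        (∑ j, (X j ⬝ᵥ θ) ^ 2 + ∑ j, (X j ⬝ᵥ θ') ^ 2))
        = ENNReal.ofReal ((∑ j, (X j ⬝ᵥ (θ - θ')) ^ 2) * ∑ j, (X j ⬝ᵥ θ) ^ 2)
        + ENNReal.ofReal ((∑ j, (X j ⬝ᵥ (θ - θ')) ^ 2) * ∑ j, (X j ⬝ᵥ θ') ^ 2) := by
      intro X
      rw [mul_add, ENNReal.ofReal_add (by positivity) (by positivity)]
    simp_rw [hadd]
    rw [lintegral_add_left (by fun_prop)]
    refine (add_le_add (lintegral_sum_sq_mul_sum_sq_le _ _)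
      (lintegral_sum_sq_mul_sum_sq_le _ _)).trans (le_of_eq ?_)
    rw [← ENNReal.ofReal_add (by positivity) (by positivity), Fintype.card_fin]
    congr 1
    ring

end ClientAffinity

/-! ### Two-point testing and Assouad's lemma -/

section Testing

variable {Ω : Type*} [MeasurableSpace Ω]

theorem three_mul_sqrt_le {x y : ℝ} (hx : 0 ≤ x) (hy : 0 ≤ y) :
    3 * √(x * y) ≤ 4 * min x y + (x + y) / 2 := by
  rw [Real.sqrt_mul hx]
  have h1 := Real.sq_sqrt hx
  have h2 := Real.sq_sqrt hy
  rcases le_total x y with h | h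
  · rw [min_eq_left h]
    nlinarith [sq_nonneg (3 * √x - √y)]
  · rw [min_eq_right h]
    nlinarith [sq_nonneg (3 * √y - √x)]

/-- Testing lower bound for two densities with Hellinger affinity at least `2/3`. -/
theorem two_point_lower_bound (Q : Measure Ω) (F G : Ω → ℝ) (hF : Measurable F)
    (hG : Measurable G) (hF0 : ∀ ω, 0 ≤ F ω) (hG0 : ∀ ω, 0 ≤ G ω)
    (hF1 : ∫⁻ ω, ENNReal.ofReal (F ω) ∂Q = 1) (hG1 : ∫⁻ ω, ENNReal.ofReal (G ω) ∂Q = 1)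
    (hA : ENNReal.ofReal (2 / 3) ≤ ∫⁻ ω, ENNReal.ofReal √(F ω * G ω) ∂Q)
    (φ ψ : Ω → ℝ≥0∞) (hφ : Measurable φ) (c : ℝ≥0∞)
    (hc : ∀ ω, c ≤ φ ω + ψ ω) :
    c ≤ 4 * (∫⁻ ω, ENNReal.ofReal (F ω) * φ ω ∂Q + ∫⁻ ω, ENNReal.ofReal (G ω) * ψ ω ∂Q) := by
  -- Affinity at least `2/3` gives `2 ≤ 4 ∫ min F G + 1`, so the two densities overlap in mass at
  -- least `1/4`.
  have hmin : 1 ≤ 4 * ∫⁻ ω, ENNReal.ofReal (min (F ω) (G ω)) ∂Q := by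
    have hpt : ∀ ω, 3 * ENNReal.ofReal √(F ω * G ω) ≤ 4 * ENNReal.ofReal (min (F ω) (G ω))
        + 2⁻¹ * (ENNReal.ofReal (F ω) + ENNReal.ofReal (G ω)) := by
      intro ω
      have h := ENNReal.ofReal_le_ofReal (three_mul_sqrt_le (hF0 ω) (hG0 ω))
      rw [ENNReal.ofReal_mul (by norm_num), ENNReal.ofReal_add
        (mul_nonneg (by norm_num) (le_min (hF0 ω) (hG0 ω)))
        (div_nonneg (add_nonneg (hF0 ω) (hG0 ω)) two_pos.le),
        ENNReal.ofReal_mul (by norm_num), ENNReal.ofReal_div_of_pos two_pos,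
        ENNReal.ofReal_add (hF0 ω) (hG0 ω), ENNReal.ofReal_ofNat, ENNReal.ofReal_ofNat,
        ENNReal.ofReal_ofNat, div_eq_mul_inv, mul_comm _ (2⁻¹ : ℝ≥0∞)] at h
      exact h
    have h := lintegral_mono (μ := Q) hpt
    rw [lintegral_const_mul _ (by fun_prop), lintegral_add_left (by fun_prop),
      lintegral_const_mul _ (by fun_prop), lintegral_const_mul _ (by fun_prop),
      lintegral_add_left (by fun_prop), hF1, hG1, one_add_one_eq_two,
      ENNReal.inv_mul_cancel two_ne_zero ENNReal.ofNat_ne_top] at h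
    have h2 : (1 : ℝ≥0∞) + 1 ≤ 3 * ∫⁻ ω, ENNReal.ofReal √(F ω * G ω) ∂Q := by
      refine le_trans (le_of_eq ?_) (mul_le_mul_right hA 3)
      rw [← ENNReal.ofReal_ofNat, ← ENNReal.ofReal_mul (by norm_num), ← ENNReal.ofReal_one,
        ← ENNReal.ofReal_add one_pos.le one_pos.le]
      norm_num
    exact (ENNReal.add_le_add_iff_right ENNReal.one_ne_top).1 (h2.trans h)
  have h1 : c * ∫⁻ ω, ENNReal.ofReal (min (F ω) (G ω)) ∂Q
      ≤ ∫⁻ ω, ENNReal.ofReal (F ω) * φ ω ∂Q + ∫⁻ ω, ENNReal.ofReal (G ω) * ψ ω ∂Q := by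
    rw [← lintegral_add_left (by fun_prop), ← lintegral_const_mul _ (by fun_prop)]
    refine lintegral_mono fun ω => ?_
    calc c * ENNReal.ofReal (min (F ω) (G ω))
        ≤ (φ ω + ψ ω) * ENNReal.ofReal (min (F ω) (G ω)) := mul_le_mul_left (hc ω) _
      _ = ENNReal.ofReal (min (F ω) (G ω)) * φ ω + ENNReal.ofReal (min (F ω) (G ω)) * ψ ω := by
          ring
      _ ≤ _ := add_le_add
          (mul_le_mul_left (ENNReal.ofReal_le_ofReal (min_le_left _ _)) _)
          (mul_le_mul_left (ENNReal.ofReal_le_ofReal (min_le_right _ _)) _)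
  calc c = c * 1 := (mul_one c).symm
    _ ≤ c * (4 * ∫⁻ ω, ENNReal.ofReal (min (F ω) (G ω)) ∂Q) := mul_le_mul_right hmin c
    _ = 4 * (c * ∫⁻ ω, ENNReal.ofReal (min (F ω) (G ω)) ∂Q) := by ring
    _ ≤ _ := mul_le_mul_right h1 4

variable {ι : Type*} [DecidableEq ι]

/-- Flip one coordinate of a Boolean vector. -/
def flipCoord (j : ι) (v : ι → Bool) : ι → Bool := Function.update v j (!v j)

theorem flipCoord_involutive (j : ι) : Function.Involutive (flipCoord j) := by
  intro v
  simp [flipCoord]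

theorem flipCoord_same (j : ι) (v : ι → Bool) : flipCoord j v j = !v j := by
  simp [flipCoord]

theorem flipCoord_of_ne {j i : ι} (h : i ≠ j) (v : ι → Bool) : flipCoord j v i = v i := by
  simp [flipCoord, h]

variable [Fintype ι]

/-- **Assouad's lemma** for a family of densities indexed by the Boolean cube. -/
theorem assouad_lower_bound (Q : Measure Ω) (F : (ι → Bool) → Ω → ℝ) (hF : ∀ v, Measurable (F v))
    (hF0 : ∀ v ω, 0 ≤ F v ω) (hF1 : ∀ v, ∫⁻ ω, ENNReal.ofReal (F v ω) ∂Q = 1)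
    (J : Finset ι)
    (hA : ∀ v, ∀ j ∈ J,
      ENNReal.ofReal (2 / 3) ≤ ∫⁻ ω, ENNReal.ofReal √(F v ω * F (flipCoord j v) ω) ∂Q)
    (ψ : ι → Bool → Ω → ℝ≥0∞) (hψ : ∀ j b, Measurable (ψ j b)) (c : ℝ≥0∞)
    (hc : ∀ j ω, c ≤ ψ j true ω + ψ j false ω) :
    2 ^ Fintype.card ι * (J.card * c)
      ≤ 8 * ∑ v, ∫⁻ ω, ENNReal.ofReal (F v ω) * ∑ j ∈ J, ψ j (v j) ω ∂Q := by
  have hsum : ∀ v, ∫⁻ ω, ENNReal.ofReal (F v ω) * ∑ j ∈ J, ψ j (v j) ω ∂Q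
      = ∑ j ∈ J, ∫⁻ ω, ENNReal.ofReal (F v ω) * ψ j (v j) ω ∂Q := by
    intro v
    simp_rw [Finset.mul_sum]
    exact lintegral_finsetSum _ fun j _ => by fun_prop
  simp_rw [hsum]
  rw [Finset.sum_comm]
  have hj : ∀ j ∈ J, 2 ^ Fintype.card ι * c
      ≤ 8 * ∑ v, ∫⁻ ω, ENNReal.ofReal (F v ω) * ψ j (v j) ω ∂Q := by
    intro j hj
    set T : (ι → Bool) → ℝ≥0∞ := fun v => ∫⁻ ω, ENNReal.ofReal (F v ω) * ψ j (v j) ω ∂Q with hT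
    -- Flipping permutes the cube, so summing the pair bound counts every vertex twice; hence `8 = 2
    -- * 4`.
    have hflip : ∑ v, T (flipCoord j v) = ∑ v, T v :=
      Equiv.sum_comp (flipCoord_involutive j).toPerm T
    have hpair : ∀ v, c ≤ 4 * (T v + T (flipCoord j v)) := by
      intro v
      refine two_point_lower_bound Q (F v) (F (flipCoord j v)) (hF _) (hF _) (hF0 _) (hF0 _)
        (hF1 _) (hF1 _) (hA v j hj) _ _ (hψ _ _) c fun ω => ?_
      rw [flipCoord_same]
      cases v j
      · rw [Bool.not_false, add_comm]; exact hc j ω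
      · exact hc j ω
    calc 2 ^ Fintype.card ι * c = ∑ _v : ι → Bool, c := by
          rw [Finset.sum_const, Finset.card_univ, nsmul_eq_mul, Fintype.card_fun,
            Fintype.card_bool]
          push_cast
          rfl
      _ ≤ ∑ v, 4 * (T v + T (flipCoord j v)) := Finset.sum_le_sum fun v _ => hpair v
      _ = 8 * ∑ v, T v := by
          rw [← Finset.mul_sum, Finset.sum_add_distrib, hflip]
          ring
  calc 2 ^ Fintype.card ι * (J.card * c) = ∑ _j ∈ J, 2 ^ Fintype.card ι * c := by
        rw [Finset.sum_const, nsmul_eq_mul]; ring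
    _ ≤ ∑ j ∈ J, 8 * ∑ v, ∫⁻ ω, ENNReal.ofReal (F v ω) * ψ j (v j) ω ∂Q :=
        Finset.sum_le_sum hj
    _ = _ := by rw [← Finset.mul_sum]

end Testing

/-! ### Tensorization over clients and averaging over signs -/

section Products

/-- Weierstrass' product inequality: affinity deficits of independent clients at most add up. -/
theorem ofReal_one_sub_sum_le_prod {ι : Type*} (s : Finset ι) (A : ι → ℝ≥0∞) (h : ι → ℝ)
    (h0 : ∀ i, 0 ≤ h i) (h1 : ∀ i, h i ≤ 1) (hA : ∀ i, 1 ≤ A i + ENNReal.ofReal (h i)) :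
    ENNReal.ofReal (1 - ∑ i ∈ s, h i) ≤ ∏ i ∈ s, A i := by
  classical
  induction s using Finset.induction_on with
  | empty => simp
  | insert a s ha ih =>
    rw [Finset.sum_insert ha, Finset.prod_insert ha]
    have hAa : ENNReal.ofReal (1 - h a) ≤ A a := by
      rw [ENNReal.ofReal_sub _ (h0 a), ENNReal.ofReal_one]
      exact tsub_le_iff_right.2 (hA a)
    refine le_trans ?_ (mul_le_mul' hAa ih)
    rw [← ENNReal.ofReal_mul (sub_nonneg.2 (h1 a))]
    refine ENNReal.ofReal_le_ofReal ?_
    nlinarith [mul_nonneg (h0 a) (Finset.sum_nonneg fun i (_ : i ∈ s) => h0 i)]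

theorem sqrt_prod_of_nonneg {ι : Type*} (s : Finset ι) (f : ι → ℝ) (hf : ∀ i, 0 ≤ f i) :
    √(∏ i ∈ s, f i) = ∏ i ∈ s, √(f i) := by
  classical
  induction s using Finset.induction_on with
  | empty => simp
  | insert a s ha ih =>
    rw [Finset.prod_insert ha, Finset.prod_insert ha, Real.sqrt_mul (hf a), ih]

variable {d M : ℕ} {n : Fin M → ℕ}

/-- Likelihood ratio of the whole dataset when all clients have independent random signs. -/
noncomputable def dataMix (θ : Fin M → Fin d → ℝ) (D : Dataset d n) : ℝ :=
  ∏ i, clientMix (θ i) (D i)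

/-- The law of the whole dataset when all regression vectors vanish. -/
noncomputable abbrev dataNull (d : ℕ) {M : ℕ} (n : Fin M → ℕ) : Measure (Dataset d n) :=
  Measure.pi fun i => clientNull d (n i)

theorem measurable_dataMix (θ : Fin M → Fin d → ℝ) :
    Measurable (dataMix θ : Dataset d n → ℝ) := by
  unfold dataMix
  fun_prop

theorem dataMix_nonneg (θ : Fin M → Fin d → ℝ) (D : Dataset d n) : 0 ≤ dataMix θ D :=
  Finset.prod_nonneg fun _ _ => (clientMix_pos _ _).le

theorem ofReal_dataMix (θ : Fin M → Fin d → ℝ) (D : Dataset d n) :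
    ENNReal.ofReal (dataMix θ D) = ∏ i, ENNReal.ofReal (clientMix (θ i) (D i)) :=
  ENNReal.ofReal_prod_of_nonneg fun _ _ => (clientMix_pos _ _).le

theorem lintegral_dataMix (θ : Fin M → Fin d → ℝ) :
    ∫⁻ D, ENNReal.ofReal (dataMix θ D) ∂dataNull d n = 1 := by
  simp_rw [ofReal_dataMix]
  rw [lintegral_pi_prod_eq (fun i => clientNull d (n i))
    (fun i D => ENNReal.ofReal (clientMix (θ i) D)) (fun _ => by fun_prop)]
  exact Finset.prod_eq_one fun i _ => lintegral_clientMix (θ i)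

theorem lintegral_sqrt_dataMix_mul (θ θ' : Fin M → Fin d → ℝ) :
    ∫⁻ D, ENNReal.ofReal √(dataMix θ D * dataMix θ' D) ∂dataNull d n
      = ∏ i, clientAffinity (n i) (θ i) (θ' i) := by
  have h : ∀ D : Dataset d n, ENNReal.ofReal √(dataMix θ D * dataMix θ' D)
      = ∏ i, ENNReal.ofReal √(clientMix (θ i) (D i) * clientMix (θ' i) (D i)) := by
    intro D
    rw [dataMix, dataMix, ← Finset.prod_mul_distrib, sqrt_prod_of_nonneg _ _ fun i =>
      (mul_pos (clientMix_pos _ _) (clientMix_pos _ _)).le,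
      ENNReal.ofReal_prod_of_nonneg fun _ _ => Real.sqrt_nonneg _]
  simp_rw [h]
  exact lintegral_pi_prod_eq (fun i => clientNull d (n i))
    (fun i D => ENNReal.ofReal √(clientMix (θ i) D * clientMix (θ' i) D)) (fun _ => by fun_prop)

/-- The real number `±1` attached to a Boolean. -/
def boolSign (b : Bool) : ℝ := if b then 1 else -1

theorem sum_prod_clientLik (θ : Fin M → Fin d → ℝ) (D : Dataset d n) :
    ∑ s : Fin M → Bool, ∏ i, ENNReal.ofReal (clientLik (boolSign (s i) • θ i) (D i))
      = 2 ^ M * ENNReal.ofReal (dataMix θ D) := by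
  have h := Finset.prod_univ_sum (fun _ : Fin M => (Finset.univ : Finset Bool))
    (fun i b => ENNReal.ofReal (clientLik (boolSign b • θ i) (D i)))
  rw [Fintype.piFinset_univ] at h
  rw [← h, ofReal_dataMix]
  have h2 : ∀ i : Fin M, ∑ b : Bool, ENNReal.ofReal (clientLik (boolSign b • θ i) (D i))
      = 2 * ENNReal.ofReal (clientMix (θ i) (D i)) := by
    intro i
    rw [Fintype.sum_bool]
    simp only [boolSign, if_true, Bool.false_eq_true, if_false, one_smul, neg_smul]
    rw [← ENNReal.ofReal_add (clientLik_pos _ _).le (clientLik_pos _ _).le,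
      ← ENNReal.ofReal_ofNat, ← ENNReal.ofReal_mul (by norm_num), clientMix,
      mul_div_cancel₀ _ (two_ne_zero' ℝ)]
  simp_rw [h2]
  rw [Finset.prod_mul_distrib, Finset.prod_const, Finset.card_univ, Fintype.card_fin]

/-- Each sign pattern is a legitimate parameter, so the worst-case risk dominates this average,
which is a risk under the mixture density. -/
theorem sum_lintegral_dataLaw {k : ℕ} (B : OrthonormalMatrix d k)
    (α : Fin M → EuclideanSpace ℝ (Fin k)) (g : Dataset d n → ℝ≥0∞) (hg : Measurable g) :
    ∑ s : Fin M → Bool, ∫⁻ D, g D ∂dataLaw n B (fun i => boolSign (s i) • α i)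
      = 2 ^ M * ∫⁻ D, ENNReal.ofReal (dataMix (fun i => B.1 *ᵥ (α i).ofLp) D) * g D
          ∂dataNull d n := by
  have hd := measurable_dataMix (n := n) fun i => B.1 *ᵥ (α i).ofLp
  rw [← lintegral_const_mul _ (by fun_prop)]
  have h : ∀ s : Fin M → Bool, ∫⁻ D, g D ∂dataLaw n B (fun i => boolSign (s i) • α i)
      = ∫⁻ D, (∏ i, ENNReal.ofReal (clientLik (boolSign (s i) • (B.1 *ᵥ (α i).ofLp)) (D i)))
          * g D ∂dataNull d n := by
    intro s
    rw [dataLaw_eq_withDensity, lintegral_withDensity_eq_lintegral_mul _ (by fun_prop) hg]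
    simp only [WithLp.ofLp_smul, Matrix.mulVec_smul]
    rfl
  simp_rw [h]
  rw [← lintegral_finsetSum _ fun s _ => by fun_prop]
  refine lintegral_congr fun D => ?_
  rw [← Finset.sum_mul, sum_prod_clientLik, mul_assoc]

end Products

/-! ### The family of spiked frames -/

section Frames

/-- Apply the operator to one basis vector, then use Cauchy–Schwarz over `J`. This trades the
spectral norm for a loss additive over coordinates. -/
theorem sum_abs_entry_le {d : ℕ} (A : Matrix (Fin d) (Fin d) ℝ) (J : Finset (Fin d)) (i₀ : Fin d) :
    ∑ j ∈ J, |A j i₀| ≤ √(J.card : ℝ) * ‖Matrix.toEuclideanCLM (n := Fin d) (𝕜 := ℝ) A‖ := by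
  have h1 : ∑ j ∈ J, A j i₀ ^ 2 ≤ ‖Matrix.toEuclideanCLM (n := Fin d) (𝕜 := ℝ) A‖ ^ 2 := by
    have h2 := (Matrix.toEuclideanCLM (n := Fin d) (𝕜 := ℝ) A).le_opNorm
      (EuclideanSpace.single i₀ 1)
    rw [PiLp.norm_single, norm_one, mul_one] at h2
    refine le_trans ?_ (pow_le_pow_left₀ (norm_nonneg _) h2 2)
    rw [EuclideanSpace.norm_sq_eq]
    have h3 : ∀ j, (Matrix.toEuclideanCLM (n := Fin d) (𝕜 := ℝ) A
        (EuclideanSpace.single i₀ 1)).ofLp j = A j i₀ := by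
      intro j
      rw [Matrix.ofLp_toEuclideanCLM]
      simp
    simp only [h3, Real.norm_eq_abs, sq_abs]
    exact Finset.sum_le_sum_of_subset_of_nonneg (Finset.subset_univ _) fun _ _ _ => sq_nonneg _
  have h2 : (∑ j ∈ J, |A j i₀|) ^ 2 ≤ J.card * ∑ j ∈ J, A j i₀ ^ 2 := by
    have := sq_sum_le_card_mul_sum_sq (s := J) (f := fun j => |A j i₀|)
    simpa only [sq_abs] using this
  refine le_of_sq_le_sq ?_ (by positivity)
  rw [mul_pow, Real.sq_sqrt (Nat.cast_nonneg _)]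
  exact h2.trans (mul_le_mul_of_nonneg_left h1 (Nat.cast_nonneg _))

variable {d k : ℕ}

/-- The frame with first column `b` and remaining columns standard basis vectors. -/
def spikedFrame (k : ℕ) (b : Fin (d + 1) → ℝ) : Matrix (Fin (d + 1)) (Fin (k + 1)) ℝ :=
  fun i l => if l = 0 then b i else if i.val = l.val then 1 else 0

theorem spikedFrame_orthonormal (hkd : k ≤ d) (b : Fin (d + 1) → ℝ) (hb : b ⬝ᵥ b = 1)
    (hb0 : ∀ i : Fin (d + 1), i ≠ 0 → i.val ≤ k → b i = 0) :
    (spikedFrame k b)ᵀ * spikedFrame k b = 1 := by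
  have hcol : ∀ l : Fin (k + 1), l ≠ 0 → ∀ i : Fin (d + 1), i.val = l.val → b i = 0 := by
    intro l hl i hi
    refine hb0 i (fun h => hl ?_) (by omega)
    apply Fin.ext
    rw [← hi, h]
    rfl
  ext p q
  simp only [Matrix.mul_apply, Matrix.transpose_apply, spikedFrame, Matrix.one_apply]
  by_cases hp : p = 0 <;> by_cases hq : q = 0
  · simpa [hp, hq, dotProduct] using hb
  · simp only [hp, hq, if_true, if_false]
    rw [if_neg (Ne.symm hq)]
    refine Finset.sum_eq_zero fun i _ => ?_
    by_cases h : i.val = q.val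
    · simp [hcol q hq i h]
    · simp [h]
  · simp only [hp, hq, if_true, if_false]
    refine Finset.sum_eq_zero fun i _ => ?_
    by_cases h : i.val = p.val
    · simp [hcol p hp i h]
    · simp [h]
  · simp only [hp, hq, if_false]
    have hlt : p.val < d + 1 := by omega
    rw [Finset.sum_eq_single (⟨p.val, hlt⟩ : Fin (d + 1))]
    · simp [Fin.ext_iff]
    · intro i _ hi
      rw [if_neg, zero_mul]
      intro h
      exact hi (Fin.ext h)
    · simp

/-- All columns but the first vanish in row `0`, so the projection entry is linear in the tail sign
of row `j` when `j` is a sign coordinate. -/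
theorem spikedFrame_mul_transpose_apply_zero (b : Fin (d + 1) → ℝ) (j : Fin (d + 1)) :
    (spikedFrame k b * (spikedFrame k b)ᵀ) j 0
      = b j * b 0 := by
  simp only [Matrix.mul_apply, Matrix.transpose_apply, spikedFrame]
  rw [Finset.sum_eq_single 0]
  · simp
  · intro l _ hl
    have : (0 : ℕ) ≠ l.val := fun h => hl (Fin.ext h.symm)
    simp [hl, this]
  · simp

theorem boolSign_sq (b : Bool) : boolSign b ^ 2 = 1 := by
  cases b <;> simp [boolSign]

theorem boolSign_not (b : Bool) : boolSign (!b) = -boolSign b := by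
  cases b <;> simp [boolSign]

/-- The coordinates that carry the unknown signs. -/
def signCoords (d k : ℕ) : Finset (Fin (d + 1)) := Finset.univ.filter fun i => k < i.val

theorem card_signCoords (hkd : k ≤ d) : (signCoords d k).card = d - k := by
  have h : signCoords d k = Finset.Ioi (⟨k, by omega⟩ : Fin (d + 1)) := by
    ext i
    simp [signCoords, Fin.lt_def]
  rw [h, Fin.card_Ioi]
  simp

theorem zero_notMem_signCoords : (0 : Fin (d + 1)) ∉ signCoords d k := by
  simp [signCoords]

/-- A unit vector near the first basis vector, with sign pattern `v` on the sign coordinates. -/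
noncomputable def spikeVector (k : ℕ) (δ : ℝ) (v : Fin (d + 1) → Bool) : Fin (d + 1) → ℝ :=
  fun i => if i = 0 then √(1 - δ ^ 2)
    else if i ∈ signCoords d k then boolSign (v i) * (δ / √((d - k : ℕ) : ℝ)) else 0

theorem spikeVector_dotProduct_self (hkd : k < d) {δ : ℝ} (hδ : δ ^ 2 ≤ 1)
    (v : Fin (d + 1) → Bool) : spikeVector k δ v ⬝ᵥ spikeVector k δ v = 1 := by
  have hP : (0 : ℝ) < ((d - k : ℕ) : ℝ) := by
    rw [Nat.cast_pos]; omega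
  have h : ∀ i, spikeVector k δ v i * spikeVector k δ v i
      = (if i = 0 then 1 - δ ^ 2 else 0)
        + (if i ∈ signCoords d k then δ ^ 2 / ((d - k : ℕ) : ℝ) else 0) := by
    intro i
    unfold spikeVector
    by_cases h0 : i = 0
    · subst h0
      simp [zero_notMem_signCoords, Real.mul_self_sqrt (sub_nonneg.2 hδ)]
    · by_cases hi : i ∈ signCoords d k
      · simp only [h0, hi, if_true, if_false, zero_add]
        rw [mul_mul_mul_comm, ← pow_two, boolSign_sq, one_mul, ← pow_two, div_pow,
          Real.sq_sqrt hP.le]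
      · simp [h0, hi]
  simp only [dotProduct, h]
  rw [Finset.sum_add_distrib, Finset.sum_ite_eq' Finset.univ, if_pos (Finset.mem_univ _),
    Finset.sum_ite_mem, Finset.univ_inter, Finset.sum_const, card_signCoords hkd.le, nsmul_eq_mul]
  field_simp
  ring

theorem spikeVector_flip (δ : ℝ) (v : Fin (d + 1) → Bool) {j : Fin (d + 1)}
    (hj : j ∈ signCoords d k) :
    (spikeVector k δ v - spikeVector k δ (flipCoord j v)) ⬝ᵥ
      (spikeVector k δ v - spikeVector k δ (flipCoord j v)) = 4 * δ ^ 2 / ((d - k : ℕ) : ℝ) := by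
  have hj0 : j ≠ 0 := fun h => zero_notMem_signCoords (h ▸ hj)
  simp only [dotProduct, Pi.sub_apply]
  rw [Finset.sum_eq_single j]
  · unfold spikeVector
    simp only [hj0, hj, if_true, if_false, flipCoord_same, boolSign_not]
    have h := boolSign_sq (v j)
    have h2 : (δ / √((d - k : ℕ) : ℝ)) ^ 2 = δ ^ 2 / ((d - k : ℕ) : ℝ) := by
      rw [div_pow, Real.sq_sqrt (Nat.cast_nonneg _)]
    calc _ = 4 * (boolSign (v j) ^ 2 * (δ / √((d - k : ℕ) : ℝ)) ^ 2) := by ring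
      _ = _ := by rw [h, h2]; ring
  · intro i _ hi
    unfold spikeVector
    rw [flipCoord_of_ne hi]
    simp
  · simp

/-- The orthonormal matrix indexed by a sign pattern. -/
noncomputable def spikedMatrix (hkd : k < d) {δ : ℝ} (hδ : δ ^ 2 ≤ 1) (v : Fin (d + 1) → Bool) :
    OrthonormalMatrix (d + 1) (k + 1) :=
  ⟨spikedFrame k (spikeVector k δ v), spikedFrame_orthonormal hkd.le _
    (spikeVector_dotProduct_self hkd hδ v) fun i h0 hi => by
      unfold spikeVector
      rw [if_neg h0, if_neg]
      simp only [signCoords, Finset.mem_filter, not_and, not_lt]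
      exact fun _ => hi⟩

/-- An entry of the first column of the projection onto the column space. -/
def projEntry {d k : ℕ} (j : Fin (d + 1)) (B : OrthonormalMatrix (d + 1) k) : ℝ :=
  (B.1 * B.1ᵀ) j 0

theorem measurable_projEntry {d k : ℕ} (j : Fin (d + 1)) :
    Measurable (projEntry j : OrthonormalMatrix (d + 1) k → ℝ) := by
  have h : Measurable fun B : OrthonormalMatrix (d + 1) k => fun i j => B.1 i j :=
    comap_measurable _
  have h' : ∀ i j, Measurable fun B : OrthonormalMatrix (d + 1) k => B.1 i j := fun i j =>
    (measurable_pi_apply j).comp ((measurable_pi_apply i).comp h)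
  unfold projEntry
  simp only [Matrix.mul_apply, Matrix.transpose_apply]
  exact Finset.measurable_sum _ fun l _ => (h' j l).mul (h' 0 l)

/-- The size of the informative entries of the projections onto the spiked frames. -/
noncomputable def spikeSize (d k : ℕ) (δ : ℝ) : ℝ := δ / √((d - k : ℕ) : ℝ) * √(1 - δ ^ 2)

theorem projEntry_spikedMatrix (hkd : k < d) {δ : ℝ} (hδ : δ ^ 2 ≤ 1) (v : Fin (d + 1) → Bool)
    {j : Fin (d + 1)} (hj : j ∈ signCoords d k) :
    projEntry j (spikedMatrix hkd hδ v) = boolSign (v j) * spikeSize d k δ := by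
  have hj0 : j ≠ 0 := fun h => zero_notMem_signCoords (h ▸ hj)
  unfold projEntry spikedMatrix
  rw [spikedFrame_mul_transpose_apply_zero]
  simp only [spikeVector, hj0, hj, if_true, if_false, spikeSize]
  ring

theorem sum_projEntry_sub_le_sinThetaDist (hkd : k < d) {δ : ℝ} (hδ : δ ^ 2 ≤ 1)
    (v : Fin (d + 1) → Bool) (B : OrthonormalMatrix (d + 1) (k + 1)) :
    ENNReal.ofReal (1 / √((d - k : ℕ) : ℝ)) * ∑ j ∈ signCoords d k,
        ENNReal.ofReal |projEntry j B - boolSign (v j) * spikeSize d k δ|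
      ≤ ENNReal.ofReal (sinThetaDist B (spikedMatrix hkd hδ v)) := by
  have hP : (0 : ℝ) < ((d - k : ℕ) : ℝ) := by
    rw [Nat.cast_pos]; omega
  rw [← ENNReal.ofReal_sum_of_nonneg fun _ _ => abs_nonneg _,
    ← ENNReal.ofReal_mul (by positivity)]
  refine ENNReal.ofReal_le_ofReal ?_
  have h := sum_abs_entry_le (B.1 * B.1ᵀ
    - (spikedMatrix hkd hδ v).1 * (spikedMatrix hkd hδ v).1ᵀ) (signCoords d k) 0
  rw [card_signCoords hkd.le] at h
  have h2 : ∑ j ∈ signCoords d k, |projEntry j B - boolSign (v j) * spikeSize d k δ|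
      = ∑ j ∈ signCoords d k, |(B.1 * B.1ᵀ
        - (spikedMatrix hkd hδ v).1 * (spikedMatrix hkd hδ v).1ᵀ) j 0| := by
    refine Finset.sum_congr rfl fun j hj => ?_
    rw [← projEntry_spikedMatrix hkd hδ v hj]
    rfl
  rw [h2, div_mul_eq_mul_div, one_mul, div_le_iff₀ (Real.sqrt_pos.2 hP), mul_comm]
  exact h

end Frames

/-! ### Assouad's bound for the spiked family -/

section CoreBound

variable {d k M : ℕ}

/-- Client coefficients along the coordinate axes. -/
noncomputable def axisCoeffs (g : Fin M → Fin (k + 1)) (τ : Fin M → ℝ) :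
    Fin M → EuclideanSpace ℝ (Fin (k + 1)) :=
  fun i => EuclideanSpace.single (g i) (τ i)

theorem spikedMatrix_mulVec_axisCoeffs (hkd : k < d) {δ : ℝ} (hδ : δ ^ 2 ≤ 1)
    (v : Fin (d + 1) → Bool) (g : Fin M → Fin (k + 1)) (τ : Fin M → ℝ) (i : Fin M) :
    (spikedMatrix hkd hδ v).1 *ᵥ (axisCoeffs g τ i).ofLp
      = τ i • fun a => spikedFrame k (spikeVector k δ v) a (g i) := by
  have h : (axisCoeffs g τ i).ofLp = τ i • Pi.single (g i) 1 := by
    funext a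
    simp [axisCoeffs, Pi.single_apply]
  rw [h, Matrix.mulVec_smul, Matrix.mulVec_single_one]
  rfl

/-- A flip moves the first column by `2δ/√P` and nothing else, so only clients with `g i = 0`
contribute, each with the better of its two deficits. -/
theorem affinity_lower_bound (hkd : k < d) {δ : ℝ} (hδ : δ ^ 2 ≤ 1) (n : Fin M → ℕ)
    (g : Fin M → Fin (k + 1)) (τ : Fin M → ℝ) {γ : ℝ} (hγ : ∀ i, g i = 0 → n i * τ i ^ 2 = γ)
    (hinf : ((Finset.univ.filter fun i => g i = 0).card : ℝ) * (min γ (γ ^ 2) * δ ^ 2)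
      ≤ ((d - k : ℕ) : ℝ) / 3072)
    (v : Fin (d + 1) → Bool) {j : Fin (d + 1)} (hj : j ∈ signCoords d k) :
    ENNReal.ofReal (2 / 3) ≤ ∫⁻ D, ENNReal.ofReal
      √(dataMix (n := n) (fun i => (spikedMatrix hkd hδ v).1 *ᵥ (axisCoeffs g τ i).ofLp) D *
        dataMix (fun i => (spikedMatrix hkd hδ (flipCoord j v)).1 *ᵥ (axisCoeffs g τ i).ofLp) D)
      ∂dataNull (d + 1) n := by
  have hP : (0 : ℝ) < ((d - k : ℕ) : ℝ) := by
    rw [Nat.cast_pos]; omega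
  rw [lintegral_sqrt_dataMix_mul]
  set P : ℝ := ((d - k : ℕ) : ℝ) with hPdef
  -- The quadratic bound gives `128 * 4 * 2 = 1024`; the linear one needs only `16`. Since `3072 = 3
  -- * 1024`, the deficits sum to at most `1/3`.
  set h : Fin M → ℝ := fun i => if g i = 0 then 1024 * (min γ (γ ^ 2) * δ ^ 2) / P else 0 with hh
  have hγ0 : ∀ i, g i = 0 → 0 ≤ γ := fun i hi => by
    rw [← hγ i hi]; positivity
  have h0 : ∀ i, 0 ≤ h i := by
    intro i
    simp only [hh]
    split_ifs with hi
    · have := le_min (hγ0 i hi) (sq_nonneg γ)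
      positivity
    · exact le_rfl
  have hsum : ∑ i, h i ≤ 1 / 3 := by
    simp only [hh]
    rw [← Finset.sum_filter, Finset.sum_const, nsmul_eq_mul]
    rw [← mul_div_assoc, div_le_iff₀ hP]
    linarith
  have h1 : ∀ i, h i ≤ 1 := fun i =>
    (Finset.single_le_sum (fun i _ => h0 i) (Finset.mem_univ i)).trans (hsum.trans (by norm_num))
  refine le_trans (ENNReal.ofReal_le_ofReal ?_)
    (ofReal_one_sub_sum_le_prod Finset.univ _ h h0 h1 fun i => ?_)
  · linarith
  simp only [spikedMatrix_mulVec_axisCoeffs]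
  by_cases hi : g i = 0
  · have e1 : ∀ w : Fin (d + 1) → Bool, (fun a => spikedFrame k (spikeVector k δ w) a (g i)) = spikeVector k δ w := by
      intro w; funext a; simp [spikedFrame, hi]
    simp only [e1]
    have hA := one_le_clientAffinity_add (m := n i) (τ i • spikeVector k δ v)
      (τ i • spikeVector k δ (flipCoord j v))
    rw [← smul_sub] at hA
    simp only [smul_dotProduct, dotProduct_smul, smul_eq_mul, spikeVector_flip δ v hj,
      spikeVector_dotProduct_self hkd hδ] at hA
    have hhi : h i = min (1024 * (γ * δ ^ 2) / P) (1024 * (γ ^ 2 * δ ^ 2) / P) := by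
      simp only [hh, hi, if_true]
      rw [min_mul_of_nonneg _ _ (sq_nonneg δ), mul_min_of_nonneg _ _ (by norm_num),
        min_div_div_right hP.le]
    rw [hhi]
    rcases min_choice (1024 * (γ * δ ^ 2) / P) (1024 * (γ ^ 2 * δ ^ 2) / P) with hm | hm
    · rw [hm]
      refine hA.1.trans (add_le_add le_rfl (ENNReal.ofReal_le_ofReal ?_))
      have hg0 := hγ0 i hi
      have e : 4 * (n i : ℝ) * (τ i * (τ i * (4 * δ ^ 2 / P))) = 16 * (γ * δ ^ 2) / P := by
        rw [← hγ i hi]; ring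
      rw [e]
      gcongr
      norm_num
    · rw [hm]
      refine hA.2.trans (add_le_add le_rfl (ENNReal.ofReal_le_ofReal (le_of_eq ?_)))
      rw [← hγ i hi]
      ring
  · have e2 : ∀ w : Fin (d + 1) → Bool, (fun a => spikedFrame k (spikeVector k δ w) a (g i))
        = fun a : Fin (d + 1) => if a.val = (g i).val then (1 : ℝ) else 0 := by
      intro w; funext a; simp [spikedFrame, hi]
    simp only [e2, clientAffinity_self]
    exact le_self_add

theorem core_lower_bound (hkd : k < d) {δ : ℝ} (hδ0 : 0 ≤ δ) (hδ : δ ^ 2 ≤ 1 / 2) (n : Fin M → ℕ)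
    (g : Fin M → Fin (k + 1)) (τ : Fin M → ℝ) {γ : ℝ} (hγ : ∀ i, g i = 0 → n i * τ i ^ 2 = γ)
    (hinf : ((Finset.univ.filter fun i => g i = 0).card : ℝ) * (min γ (γ ^ 2) * δ ^ 2)
      ≤ ((d - k : ℕ) : ℝ) / 3072)
    (E : SubspaceEstimator (d + 1) (k + 1) M) (S : ℝ≥0∞)
    (hS : ∀ (B : OrthonormalMatrix (d + 1) (k + 1)) (s : Fin M → Bool),
      subspaceRisk E B (fun i => boolSign (s i) • axisCoeffs g τ i) n ≤ S) :
    ENNReal.ofReal (δ / 6) ≤ S := by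
  have hδ1 : δ ^ 2 ≤ 1 := hδ.trans (by norm_num)
  have hP : (0 : ℝ) < ((d - k : ℕ) : ℝ) := by
    rw [Nat.cast_pos]; omega
  have := E.isMarkov n
  set β := spikeSize d k δ with hβ
  have hβ0 : 0 ≤ β := by
    rw [hβ, spikeSize]; positivity
  set w : ℝ≥0∞ := ENNReal.ofReal (1 / √((d - k : ℕ) : ℝ)) with hw
  set f : Fin (d + 1) → Bool → OrthonormalMatrix (d + 1) (k + 1) → ℝ≥0∞ :=
    fun j b B => ENNReal.ofReal |projEntry j B - boolSign b * β| with hf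
  have hfm : ∀ j b, Measurable (f j b) := fun j b => by
    have := measurable_projEntry (k := k + 1) j
    simp only [hf]
    fun_prop
  set ψ : Fin (d + 1) → Bool → Dataset (d + 1) n → ℝ≥0∞ :=
    fun j b D => ∫⁻ B, f j b B ∂E.kernel n D with hψ
  have hψm : ∀ j b, Measurable (ψ j b) := fun j b => (hfm j b).lintegral_kernel
  -- The two candidate values `±β` of an entry are `2β` apart, so no estimate is close to both.
  have hc : ∀ j D, ENNReal.ofReal (2 * β) ≤ ψ j true D + ψ j false D := by
    intro j D
    simp only [hψ]
    rw [← lintegral_add_left (hfm j true)]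
    calc ENNReal.ofReal (2 * β) = ∫⁻ _, ENNReal.ofReal (2 * β) ∂E.kernel n D := by simp
      _ ≤ _ := lintegral_mono fun B => by
        simp only [hf]
        rw [← ENNReal.ofReal_add (abs_nonneg _) (abs_nonneg _)]
        refine ENNReal.ofReal_le_ofReal ?_
        simp only [boolSign, if_true, Bool.false_eq_true, if_false]
        have h1 := neg_le_abs (projEntry j B - 1 * β)
        have h2 := le_abs_self (projEntry j B - -1 * β)
        linarith
  have hassouad := assouad_lower_bound (dataNull (d + 1) n)
    (fun v => dataMix fun i => (spikedMatrix hkd hδ1 v).1 *ᵥ (axisCoeffs g τ i).ofLp)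
    (fun v => measurable_dataMix _) (fun v => dataMix_nonneg _) (fun v => lintegral_dataMix _)
    (signCoords d k) (fun v j hj => affinity_lower_bound hkd hδ1 n g τ hγ hinf v hj)
    ψ hψm (ENNReal.ofReal (2 * β)) hc
  have hrisk : ∀ v, 2 ^ M * (w * ∫⁻ D, ENNReal.ofReal (dataMix (fun i =>
      (spikedMatrix hkd hδ1 v).1 *ᵥ (axisCoeffs g τ i).ofLp) D) *
        ∑ j ∈ signCoords d k, ψ j (v j) D ∂dataNull (d + 1) n) ≤ 2 ^ M * S := by
    intro v
    have hd := measurable_dataMix (n := n) fun i =>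
      (spikedMatrix hkd hδ1 v).1 *ᵥ (axisCoeffs g τ i).ofLp
    have hsm : Measurable fun D => ∑ j ∈ signCoords d k, ψ j (v j) D :=
      Finset.measurable_sum _ fun j _ => hψm j (v j)
    have h1 := sum_lintegral_dataLaw (spikedMatrix hkd hδ1 v) (axisCoeffs g τ)
      (fun D : Dataset (d + 1) n => w * ∑ j ∈ signCoords d k, ψ j (v j) D) (hsm.const_mul w)
    have h2 : ∀ D, ENNReal.ofReal (dataMix (n := n) (fun i =>
        (spikedMatrix hkd hδ1 v).1 *ᵥ (axisCoeffs g τ i).ofLp) D) *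
          (w * ∑ j ∈ signCoords d k, ψ j (v j) D)
        = w * (ENNReal.ofReal (dataMix (fun i =>
        (spikedMatrix hkd hδ1 v).1 *ᵥ (axisCoeffs g τ i).ofLp) D) *
          ∑ j ∈ signCoords d k, ψ j (v j) D) := fun D => by ring
    simp_rw [h2] at h1
    rw [lintegral_const_mul _ (by fun_prop)] at h1
    rw [← h1]
    calc _ ≤ ∑ _s : Fin M → Bool, S := by
          refine Finset.sum_le_sum fun s _ => le_trans ?_ (hS (spikedMatrix hkd hδ1 v) s)
          unfold subspaceRisk
          refine lintegral_mono fun D => ?_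
          simp only [hψ]
          rw [← lintegral_finsetSum _ fun j _ => hfm j (v j),
            ← lintegral_const_mul _ (Finset.measurable_sum _ fun j _ => hfm j (v j))]
          exact lintegral_mono fun B => sum_projEntry_sub_le_sinThetaDist hkd hδ1 v B
      _ = 2 ^ M * S := by
          rw [Finset.sum_const, Finset.card_univ, nsmul_eq_mul, Fintype.card_fun,
            Fintype.card_bool, Fintype.card_fin]
          push_cast
          rfl
  have hcancel : ∀ (m : ℕ) {x y : ℝ≥0∞}, 2 ^ m * x ≤ 2 ^ m * y → x ≤ y := fun m x y h =>
    (ENNReal.mul_le_mul_iff_right (pow_ne_zero _ two_ne_zero)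
      (ENNReal.pow_ne_top ENNReal.ofNat_ne_top)).1 h
  have hfinal : w * ((signCoords d k).card * ENNReal.ofReal (2 * β)) ≤ 8 * S := by
    refine hcancel (Fintype.card (Fin (d + 1))) ?_
    calc _ = w * (2 ^ Fintype.card (Fin (d + 1)) *
          ((signCoords d k).card * ENNReal.ofReal (2 * β))) := by ring
      _ ≤ w * (8 * ∑ v : Fin (d + 1) → Bool, _) := mul_le_mul_right hassouad w
      _ = 8 * ∑ v : Fin (d + 1) → Bool, w * _ := by rw [← Finset.mul_sum]; ring
      _ ≤ 8 * ∑ v : Fin (d + 1) → Bool, S :=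
          mul_le_mul_right (Finset.sum_le_sum fun v _ => hcancel M (hrisk v)) 8
      _ = _ := by
          rw [Finset.sum_const, Finset.card_univ, nsmul_eq_mul, Fintype.card_fun,
            Fintype.card_bool]
          push_cast
          ring
  rw [card_signCoords hkd.le, hw, ← ENNReal.ofReal_natCast, ← ENNReal.ofReal_mul hP.le,
    ← ENNReal.ofReal_mul (by positivity)] at hfinal
  -- `δ² ≤ 1/2` gives `2δ√(1 - δ²) ≥ (4/3)δ`, and the `8` comes from Assouad.
  have h8 : ENNReal.ofReal (8 * (δ / 6)) ≤ 8 * S := by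
    refine le_trans (ENNReal.ofReal_le_ofReal ?_) hfinal
    have hs := Real.sqrt_pos.2 hP
    have e : 1 / √((d - k : ℕ) : ℝ) * (((d - k : ℕ) : ℝ) * (2 * β)) = 2 * δ * √(1 - δ ^ 2) := by
      rw [hβ, spikeSize]
      field_simp
      rw [Real.sq_sqrt hP.le]
    rw [e]
    have hsq : 2 / 3 ≤ √(1 - δ ^ 2) := Real.le_sqrt_of_sq_le (by linarith)
    nlinarith
  rw [ENNReal.ofReal_mul (by norm_num), ENNReal.ofReal_ofNat] at h8
  exact (ENNReal.mul_le_mul_iff_right (by norm_num) ENNReal.ofNat_ne_top).1 h8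

end CoreBound

/-! ### Client coefficients, volumes and groups -/

section Parameters

/-- Off-diagonal entries vanish since each client loads on one axis, and signs enter squared. Each
axis has total weight `A * N`, split evenly within its group. -/
theorem diversityMatrix_axisCoeffs {k M N : ℕ} (hN : 0 < N) (g : Fin M → Fin (k + 1))
    (τ : Fin M → ℝ) (n : Fin M → ℕ) (s : Fin M → Bool) (A : ℝ)
    (hpos : ∀ j, 0 < (Finset.univ.filter fun i => g i = j).card)
    (hτ : ∀ i, n i * τ i ^ 2 = A * N / (Finset.univ.filter fun i' => g i' = g i).card) :
    diversityMatrix N (fun i => boolSign (s i) • axisCoeffs g τ i) n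
      = A • (1 : Matrix (Fin (k + 1)) (Fin (k + 1)) ℝ) := by
  have hN' : (N : ℝ) ≠ 0 := by positivity
  ext p q
  simp only [diversityMatrix, Matrix.smul_apply, Matrix.sum_apply, Matrix.vecMulVec_apply,
    smul_eq_mul, axisCoeffs, WithLp.ofLp_smul, Pi.smul_apply, PiLp.single_apply]
  have h : ∀ i, (n i : ℝ) * ((boolSign (s i) * if p = g i then τ i else 0) *
      (boolSign (s i) * if q = g i then τ i else 0))
      = if g i = p then (if p = q then
        A * N / (Finset.univ.filter fun i' => g i' = p).card else 0) else 0 := by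
    intro i
    by_cases hp : g i = p
    · subst hp
      by_cases hq : g i = q
      · subst hq
        simp only [if_true]
        rw [← hτ i]
        have := boolSign_sq (s i)
        calc _ = boolSign (s i) ^ 2 * (n i * τ i ^ 2) := by ring
          _ = _ := by rw [this, one_mul]
      · simp [hq, Ne.symm hq]
    · simp [hp, Ne.symm hp]
  simp only [h]
  rw [← Finset.sum_filter, Finset.sum_const, nsmul_eq_mul, Matrix.one_apply]
  have hp : ((Finset.univ.filter fun i => g i = p).card : ℝ) ≠ 0 :=
    Nat.cast_ne_zero.2 (hpos p).ne'
  split_ifs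
  · field_simp
  · simp

theorem axisCoeffs_mem_paramSpace {k M N : ℕ} (hN : 0 < N) (g : Fin M → Fin (k + 1))
    (τ : Fin M → ℝ) (n : Fin M → ℕ) (s : Fin M → Bool) {A K a b : ℝ}
    (hpos : ∀ j, 0 < (Finset.univ.filter fun i => g i = j).card)
    (hτ : ∀ i, n i * τ i ^ 2 = A * N / (Finset.univ.filter fun i' => g i' = g i).card)
    (hK : ∀ i, |τ i| ≤ K) (hn : ∀ i, 0 < n i) (hsum : ∑ i, n i = N) (ha : a ≤ A) (hb : A ≤ b) :
    ((fun i => boolSign (s i) • axisCoeffs g τ i, n) :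
      (Fin M → EuclideanSpace ℝ (Fin (k + 1))) × (Fin M → ℕ)) ∈ paramSpace (k + 1) M N K a b := by
  refine ⟨fun i => ?_, hn, hsum, ?_, ?_⟩
  · have h1 : ‖boolSign (s i)‖ = 1 := by
      cases s i <;> simp [boolSign]
    simp only [norm_smul, h1, one_mul, axisCoeffs, PiLp.norm_single, Real.norm_eq_abs]
    exact hK i
  · simp only [diversityMatrix_axisCoeffs hN g τ n s A hpos hτ]
    rw [← sub_smul]
    exact Matrix.PosSemidef.one.smul (sub_nonneg.2 ha)
  · simp only [diversityMatrix_axisCoeffs hN g τ n s A hpos hτ]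
    rw [← sub_smul]
    exact Matrix.PosSemidef.one.smul (sub_nonneg.2 hb)

theorem exists_balanced_volumes {M N : ℕ} (hM : 0 < M) (hMN : M ≤ N) :
    ∃ n : Fin M → ℕ, ∑ i, n i = N ∧ ∀ i, 0 < n i ∧ N ≤ 2 * M * n i := by
  have hq : 0 < N / M := Nat.div_pos hMN hM
  have hmod := Nat.div_add_mod N M
  have hlt := Nat.mod_lt N hM
  refine ⟨fun i => N / M + if i = ⟨0, hM⟩ then N % M else 0, ?_, fun i =>
    ⟨Nat.add_pos_left hq _, ?_⟩⟩
  · rw [Finset.sum_add_distrib, Finset.sum_const, Finset.card_univ, Fintype.card_fin, smul_eq_mul,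
      Finset.sum_ite_eq' Finset.univ, if_pos (Finset.mem_univ _)]
    exact hmod
  · have h1 : N ≤ 2 * M * (N / M) := by nlinarith
    exact h1.trans (Nat.mul_le_mul_left _ (Nat.le_add_right _ _))

/-- Two demands compete: every axis needs a share of order `M / (k + 1)` to keep coefficients
bounded, and axis `0` needs a fixed fraction of all clients. The slack `ρ` guarantees enough
leftover clients when `M` is close to `k + 1`. -/
theorem exists_group_assignment {k M : ℕ} {ρ : ℝ} (hρ : 0 < ρ)
    (hM : (1 + ρ) * ((k + 1 : ℕ) : ℝ) ≤ M) :
    ∃ g : Fin M → Fin (k + 1),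
      (∀ j, M ≤ 4 * (k + 1) * (Finset.univ.filter fun i => g i = j).card) ∧
      min (ρ / (1 + ρ)) (1 / 2) * M ≤ (Finset.univ.filter fun i => g i = 0).card := by
  have hk0 : (0 : ℝ) < ((k + 1 : ℕ) : ℝ) := by positivity
  have hkM : k + 1 ≤ M := by
    have : ((k + 1 : ℕ) : ℝ) ≤ M := by nlinarith
    exact_mod_cast this
  obtain ⟨m, hm1, hm2, hm3⟩ : ∃ m : ℕ, (k + 1) * m ≤ M ∧ M ≤ 4 * (k + 1) * m ∧
      min (ρ / (1 + ρ)) (1 / 2) * M ≤ ((M - (k + 1) * m : ℕ) : ℝ) := by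
    by_cases h : M < 2 * (k + 1)
    · refine ⟨1, by omega, by omega, ?_⟩
      rw [Nat.cast_sub (by omega), mul_one]
      refine (mul_le_mul_of_nonneg_right (min_le_left _ _) (Nat.cast_nonneg M)).trans ?_
      rw [div_mul_eq_mul_div, div_le_iff₀ (by positivity)]
      nlinarith
    · have hdm := Nat.div_add_mod M (2 * (k + 1))
      have hlt := Nat.mod_lt M (show 0 < 2 * (k + 1) by omega)
      have hq : 0 < M / (2 * (k + 1)) := Nat.div_pos (by omega) (by omega)
      set q := M / (2 * (k + 1))
      have h2 : 2 * ((k + 1) * q) ≤ M := by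
        rw [← mul_assoc]
        omega
      refine ⟨q, by omega, by nlinarith, ?_⟩
      rw [Nat.cast_sub (by omega)]
      refine (mul_le_mul_of_nonneg_right (min_le_right _ _) (Nat.cast_nonneg M)).trans ?_
      have h3 : 2 * (((k + 1) * q : ℕ) : ℝ) ≤ M := by exact_mod_cast h2
      linarith
  -- The first `(k + 1) * m` clients are dealt round-robin; all leftovers go to axis `0`.
  refine ⟨fun i => if i.val < (k + 1) * m then ⟨i.val % (k + 1), Nat.mod_lt _ (by omega)⟩ else 0,
    fun j => ?_, ?_⟩
  · refine hm2.trans (Nat.mul_le_mul_left _ ?_)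
    have hb : ∀ t : Fin m, j.val + (k + 1) * t.val < (k + 1) * m := by
      intro t
      have h1 : (k + 1) * (t.val + 1) ≤ (k + 1) * m := Nat.mul_le_mul_left _ t.2
      have h2 := j.2
      rw [Nat.mul_add] at h1
      omega
    have hle : (Finset.univ : Finset (Fin m)).card
        ≤ (Finset.univ.filter fun i : Fin M => (if i.val < (k + 1) * m then
          (⟨i.val % (k + 1), Nat.mod_lt _ (by omega)⟩ : Fin (k + 1)) else 0) = j).card := by
      refine Finset.card_le_card_of_injOn
        (fun t => ⟨j.val + (k + 1) * t.val, (hb t).trans_le hm1⟩) (fun t _ => ?_) ?_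
      · simp only [Finset.coe_filter, Finset.mem_univ, true_and, Set.mem_ofPred_eq, hb t, if_true]
        apply Fin.ext
        simp [Nat.mod_eq_of_lt j.2]
      · intro t _ t' _ htt
        simp only [Fin.mk.injEq, Nat.add_left_cancel_iff] at htt
        exact Fin.ext (Nat.eq_of_mul_eq_mul_left (by omega) htt)
    rwa [Finset.card_univ, Fintype.card_fin] at hle
  · refine hm3.trans (Nat.cast_le.2 ?_)
    have hle : (Finset.univ : Finset (Fin (M - (k + 1) * m))).card
        ≤ (Finset.univ.filter fun i : Fin M => (if i.val < (k + 1) * m then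
          (⟨i.val % (k + 1), Nat.mod_lt _ (by omega)⟩ : Fin (k + 1)) else 0) = 0).card := by
      refine Finset.card_le_card_of_injOn
        (fun t => ⟨(k + 1) * m + t.val, by have := t.2; omega⟩) (fun t _ => ?_) ?_
      · simp
      · intro t _ t' _ htt
        simp only [Fin.mk.injEq, Nat.add_left_cancel_iff] at htt
        exact Fin.ext htt
    rwa [Finset.card_univ, Fintype.card_fin] at hle

end Parameters

/-! ### Choice of the separation and conclusion -/

section MainBound

/-- The two rate terms are matched with the two branches of the minimum. Each costs at most `P`,
`r²` is at most twice their sum, and `12288 = 4 * 3072` absorbs both factors of two. -/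
theorem information_bound {a p c₂ κ lam d M N m P r : ℝ} (ha : 0 < a) (hlam : 0 < lam)
    (hN : 0 < N) (hM : 0 < M) (hd : 0 < d) (hc₂ : 0 < c₂) (hκ : 0 ≤ κ)
    (hκ1 : κ * a ≤ p) (hκ2 : κ * a ^ 2 ≤ p * c₂) (hP : p * d ≤ P) (hm : c₂ * M ≤ m)
    (hr : r = √(d / (N * lam)) + √(M * d / (N ^ 2 * lam ^ 2))) :
    m * (min (a * lam * N / m) ((a * lam * N / m) ^ 2) * (κ / 12288 * r ^ 2)) ≤ P / 3072 := by
  have hm0 : 0 < m := (mul_pos hc₂ hM).trans_le hm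
  set x := d / (N * lam) with hx
  set y := M * d / (N ^ 2 * lam ^ 2) with hy
  have hx0 : 0 ≤ x := by positivity
  have hy0 : 0 ≤ y := by positivity
  have hr2 : r ^ 2 ≤ 2 * (x + y) := by
    rw [hr]
    nlinarith [Real.sq_sqrt hx0, Real.sq_sqrt hy0, sq_nonneg (√x - √y)]
  set μ := min (a * lam * N / m) ((a * lam * N / m) ^ 2) with hμ
  have hμ0 : 0 ≤ μ := le_min (by positivity) (by positivity)
  have h1 : m * (μ * (κ * x)) ≤ P := by
    calc m * (μ * (κ * x)) ≤ m * (a * lam * N / m * (κ * x)) := by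
          gcongr
          exact min_le_left _ _
      _ = κ * a * d := by rw [hx]; field_simp
      _ ≤ p * d := by gcongr
      _ ≤ P := hP
  have h2 : m * (μ * (κ * y)) ≤ P := by
    calc m * (μ * (κ * y)) ≤ m * ((a * lam * N / m) ^ 2 * (κ * y)) := by
          gcongr
          exact min_le_right _ _
      _ = κ * a ^ 2 * (M * d) / m := by rw [hy]; field_simp
      _ ≤ p * c₂ * (M * d) / m := by gcongr
      _ ≤ p * d := by
          rw [div_le_iff₀ hm0]
          have hpd : 0 ≤ p * d := by
            have : 0 ≤ κ * a := by positivity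
            exact mul_nonneg (this.trans hκ1) hd.le
          nlinarith [mul_le_mul_of_nonneg_left hm hpd]
      _ ≤ P := hP
  have h3 : m * (μ * (κ / 12288 * r ^ 2)) ≤ m * (μ * (κ / 12288 * (2 * (x + y)))) := by
    gcongr
  linarith

theorem minimax_lower_bound {ρ₁ ρ₂ C₀ K U a p c₂ κ : ℝ} (hρ₂ : 0 < ρ₂)
    (hK : 0 < K) (ha : 0 < a) (haU : a ≤ U) (haK : 8 * a * C₀ ≤ K ^ 2) (hρ₁ : 0 < ρ₁)
    (hp : p = ρ₁ / (1 + ρ₁)) (hc₂ : c₂ = min (ρ₂ / (1 + ρ₂)) (1 / 2))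
    (hκ : 0 < κ) (hκ0 : κ ≤ 1) (hκ1 : κ * a ≤ p) (hκ2 : κ * a ^ 2 ≤ p * c₂)
    {ℓ : ℝ} (hℓ : ℓ ≤ a) {d k M N : ℕ} {lam1 lamk : ℝ} (hMN : M ≤ N)
    (hlamk : 0 < lamk) (hlam : lamk ≤ lam1) (hkC : ((k + 1 : ℕ) : ℝ) * lamk ≤ C₀)
    (hd : (1 + ρ₁) * ((k + 1 : ℕ) : ℝ) ≤ ((d + 1 : ℕ) : ℝ))
    (hM : (1 + ρ₂) * ((k + 1 : ℕ) : ℝ) ≤ (M : ℝ)) :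
    ENNReal.ofReal (√(κ / 12288) / 6 * min
        (√(((d + 1 : ℕ) : ℝ) / (N * lamk)) +
          √(M * ((d + 1 : ℕ) : ℝ) / ((N : ℝ) ^ 2 * lamk ^ 2))) 1)
      ≤ subspaceMinimaxRisk (d + 1) (k + 1) M N K (ℓ * lamk) (U * lam1) := by
  have hk0 : (0 : ℝ) < ((k + 1 : ℕ) : ℝ) := by positivity
  have hkd : k < d := by
    have h : ((k + 1 : ℕ) : ℝ) < ((d + 1 : ℕ) : ℝ) := by nlinarith
    have h' : k + 1 < d + 1 := by exact_mod_cast h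
    omega
  have hM0 : 0 < M := by
    have : (0 : ℝ) < M := lt_of_lt_of_le (by positivity) hM
    exact_mod_cast this
  have hN0 : 0 < N := hM0.trans_le hMN
  have hMr : (0 : ℝ) < M := Nat.cast_pos.2 hM0
  have hNr : (0 : ℝ) < N := Nat.cast_pos.2 hN0
  obtain ⟨g, hg, hg0⟩ := exists_group_assignment hρ₂ hM
  obtain ⟨n, hnsum, hn⟩ := exists_balanced_volumes hM0 hMN
  rw [← hc₂] at hg0
  have hc₂0 : 0 < c₂ := by
    rw [hc₂]
    exact lt_min (by positivity) (by norm_num)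
  have hpos : ∀ j, 0 < (Finset.univ.filter fun i => g i = j).card := by
    intro j
    by_contra h
    have h' : (Finset.univ.filter fun i => g i = j).card = 0 := by omega
    have := hg j
    rw [h', mul_zero] at this
    omega
  set m : Fin (k + 1) → ℝ := fun j => ((Finset.univ.filter fun i => g i = j).card : ℝ) with hm
  have hm0 : ∀ j, 0 < m j := fun j => Nat.cast_pos.2 (hpos j)
  -- Dividing by `n i` equalizes the signal strength within each group.
  set τ : Fin M → ℝ := fun i => √(a * lamk * N / (n i * m (g i))) with hτdef
  have hτ2 : ∀ i, τ i ^ 2 = a * lamk * N / (n i * m (g i)) := by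
    intro i
    have := hm0 (g i)
    exact Real.sq_sqrt (by positivity)
  have hτ : ∀ i, n i * τ i ^ 2 = a * lamk * N / m (g i) := by
    intro i
    have h1 := hm0 (g i)
    have h2 : (0 : ℝ) < n i := Nat.cast_pos.2 (hn i).1
    rw [hτ2]
    field_simp
  -- From `n i ≥ N / (2M)` and a group size at least `M / (4(k + 1))`, `τ i ^ 2 ≤ 8 a (k + 1) λ_k ≤
  -- 8 a C₀`.
  have hτK : ∀ i, |τ i| ≤ K := by
    intro i
    refine abs_le_of_sq_le_sq ?_ hK.le
    rw [hτ2]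
    have h1 := hm0 (g i)
    have h2 : (0 : ℝ) < n i := Nat.cast_pos.2 (hn i).1
    rw [div_le_iff₀ (by positivity)]
    have e1 : (N : ℝ) ≤ 2 * M * n i := by exact_mod_cast (hn i).2
    have e2 : (M : ℝ) ≤ 4 * ((k + 1 : ℕ) : ℝ) * m (g i) := by
      simp only [hm]
      exact_mod_cast hg (g i)
    have e3 : (N : ℝ) ≤ 8 * ((k + 1 : ℕ) : ℝ) * (n i * m (g i)) := by nlinarith
    calc a * lamk * N ≤ a * lamk * (8 * ((k + 1 : ℕ) : ℝ) * (n i * m (g i))) := by gcongr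
      _ = 8 * a * (((k + 1 : ℕ) : ℝ) * lamk) * (n i * m (g i)) := by ring
      _ ≤ 8 * a * C₀ * (n i * m (g i)) := by gcongr
      _ ≤ K ^ 2 * (n i * m (g i)) := by gcongr
  set r := √(((d + 1 : ℕ) : ℝ) / (N * lamk)) +
    √(M * ((d + 1 : ℕ) : ℝ) / ((N : ℝ) ^ 2 * lamk ^ 2)) with hr
  have hr0 : 0 ≤ r := by positivity
  set δ := √(κ / 12288) * min r 1 with hδ
  have hmin0 : 0 ≤ min r 1 := le_min hr0 one_pos.le
  have hδ0 : 0 ≤ δ := mul_nonneg (Real.sqrt_nonneg _) hmin0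
  have hδ2 : δ ^ 2 = κ / 12288 * min r 1 ^ 2 := by
    rw [hδ, mul_pow, Real.sq_sqrt (by positivity)]
  have hδhalf : δ ^ 2 ≤ 1 / 2 := by
    have : min r 1 ^ 2 ≤ 1 := pow_le_one₀ hmin0 (min_le_right _ _)
    rw [hδ2]
    nlinarith
  have hPd : p * ((d + 1 : ℕ) : ℝ) ≤ ((d - k : ℕ) : ℝ) := by
    rw [Nat.cast_sub hkd.le, hp, div_mul_eq_mul_div, div_le_iff₀ (by positivity)]
    push_cast at hd ⊢
    nlinarith
  have hinfo : m 0 * (min (a * lamk * N / m 0) ((a * lamk * N / m 0) ^ 2) * δ ^ 2)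
      ≤ ((d - k : ℕ) : ℝ) / 3072 := by
    refine le_trans ?_ (information_bound ha hlamk hNr hMr (by positivity) hc₂0 hκ.le hκ1 hκ2
      hPd hg0 hr)
    have h1 := hm0 0
    rw [hδ2]
    have h2 : min r 1 ^ 2 ≤ r ^ 2 := pow_le_pow_left₀ hmin0 (min_le_left _ _) 2
    have h3 : 0 ≤ min (a * lamk * N / m 0) ((a * lamk * N / m 0) ^ 2) :=
      le_min (by positivity) (by positivity)
    gcongr
  rw [div_mul_eq_mul_div, ← hδ]
  unfold subspaceMinimaxRisk
  refine le_iInf fun E => ?_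
  refine core_lower_bound hkd hδ0 hδhalf n g τ (γ := a * lamk * N / m 0)
    (fun i hi => by rw [hτ i, hi]) hinfo E _ fun B s => ?_
  refine le_trans ?_ (le_iSup _ B)
  refine le_iSup₂_of_le (fun i => boolSign (s i) • axisCoeffs g τ i, n) ?_ le_rfl
  refine axisCoeffs_mem_paramSpace hN0 g τ n s (A := a * lamk) hpos hτ hτK
    (fun i => (hn i).1) hnsum ?_ ?_
  · exact mul_le_mul_of_nonneg_right hℓ hlamk.le
  · exact mul_le_mul haU hlam hlamk.le (ha.le.trans haU)

end MainBound

theorem mainTheorem2 (ρ₁ ρ₂ c₀ C₀ K U : ℝ) (hρ₁ : 0 < ρ₁) (hρ₂ : 0 < ρ₂)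
    (hc₀ : 0 < c₀) (hC₀ : 0 < C₀) (hK : 0 < K) (hU : 0 < U) :
    ∃ ℓ₀ : ℝ, 0 < ℓ₀ ∧ ∃ c : ℝ, 0 < c ∧
      ∀ ℓ : ℝ, 0 < ℓ → ℓ ≤ ℓ₀ →
      ∀ (d k M N : ℕ) (lam1 lamk : ℝ),
        1 ≤ k → M ≤ N →
        0 < lamk → lamk ≤ lam1 → (k : ℝ) * lamk ≤ C₀ →
        c₀ * Real.log (M : ℝ) ≤ (k : ℝ) →
        (1 + ρ₁) * (k : ℝ) ≤ (d : ℝ) →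
        (1 + ρ₂) * (k : ℝ) ≤ (M : ℝ) →
        ENNReal.ofReal (c * min
            (Real.sqrt ((d : ℝ) / ((N : ℝ) * lamk)) +
              Real.sqrt ((M : ℝ) * (d : ℝ) / ((N : ℝ) ^ 2 * lamk ^ 2))) 1)
          ≤ subspaceMinimaxRisk d k M N K (ℓ * lamk) (U * lam1) := by
  -- The diversity matrix will be `a * lamk` times the identity: `U` caps its size, the other term
  -- enforces the norm bound. The same `a` serves as `ℓ₀`.
  set a := min U (K ^ 2 / (8 * C₀)) with ha
  set p := ρ₁ / (1 + ρ₁) with hp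
  set c₂ := min (ρ₂ / (1 + ρ₂)) (1 / 2) with hc₂
  have ha0 : 0 < a := lt_min hU (by positivity)
  have hp0 : 0 < p := by positivity
  have hc₂0 : 0 < c₂ := lt_min (by positivity) (by norm_num)
  -- The inner terms make the linear and the quadratic information fit the budget; the `1` keeps `δ²
  -- ≤ 1/2`.
  set κ := min 1 (min (p / a) (p * c₂ / a ^ 2)) with hκ
  have hκ0 : 0 < κ := lt_min one_pos (lt_min (by positivity) (by positivity))
  have haK : 8 * a * C₀ ≤ K ^ 2 := by
    have h : a ≤ K ^ 2 / (8 * C₀) := min_le_right _ _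
    rw [le_div_iff₀ (by positivity)] at h
    linarith
  have hκ1 : κ * a ≤ p :=
    (le_div_iff₀ ha0).1 ((min_le_right _ _).trans (min_le_left _ _))
  have hκ2 : κ * a ^ 2 ≤ p * c₂ :=
    (le_div_iff₀ (by positivity)).1 ((min_le_right _ _).trans (min_le_right _ _))
  refine ⟨a, ha0, √(κ / 12288) / 6, by positivity, ?_⟩
  intro ℓ _ hℓ d k M N lam1 lamk hk hMN hlamk hlam hkC _ hd hM
  obtain ⟨k, rfl⟩ : ∃ k', k = k' + 1 := ⟨k - 1, by omega⟩
  have hd0 : 0 < d := by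
    have : (0 : ℝ) < d := lt_of_lt_of_le (by positivity) hd
    exact_mod_cast this
  obtain ⟨d, rfl⟩ : ∃ d', d = d' + 1 := ⟨d - 1, by omega⟩
  exact minimax_lower_bound hρ₂ hK ha0 (min_le_left _ _) haK hρ₁ hp hc₂ hκ0 (min_le_left _ _)
    hκ1 hκ2 hℓ hMN hlamk hlam hkC hd hM
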